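/- Theorem 2.1 (Phg mapping properties of $R$). Let $n\ge 2$, let $\overline\Omega=\{x\in\mathbb{R}^n:|x|\le 1\}$, $\rho(x)=1-|x|^2$, and for $(s,\theta)\in\mathbb{R}\times S^{n-1}$ let $Ru(s,\theta)=\int_{s\theta+\theta^\perp}u\,d\mu_{(s,\theta)}$ be the Radon transform, where $\mu_{(s,\theta)}$ is the $(n-1)$-dimensional Lebesgue measure on the hyperplane $s\theta+\theta^\perp$; let $\sigma=1-s^2$. Let $a\in C^\infty(S^{n-1})$ be complex-valued, $\tilde a(x)=a(x/|x|)$. For $\theta\in S^{n-1}$ the function $$F(q;\theta)=\int_{S^{n-1}\cap\theta^\perp}a\Big(\frac{\theta+q\phi}{\sqrt{1+q^2}}\Big)\,d\phi,\qquad q\in\mathbb{R},$$ where $d\phi$ is the surface measure of the unit sphere of $\theta^\perp$ (counting measure if $n=2$), is $C^\infty$; put $$A_p(\theta)=\frac12\cdot\frac{1}{(2p)!}\,\partial_q^{2p}F(0;\theta),\qquad p\in\mathbb{N}_0 .$$ Then $A_p\in C^\infty(S^{n-1})$ for every $p$, and the following holds for all $\gamma\in\mathbb{C}$ with $\operatorname{Re}\gamma>-1$,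 all $\ell\in\mathbb{N}_0$ and every real-valued $\chi\in C_c^\infty[0,1)$ with $\chi\equiv 1$ near $0$. The function $u=\tilde a\,\rho^\gamma\log(\rho)^\ell\chi(\rho)$ on $\{|x|<1\}$, extended by zero to $\mathbb{R}^n$, is integrable on every hyperplane, and near $\sigma=0$ $$Ru(s,\theta)\sim\sum_{m=0}^\infty\sum_{k=0}^{\ell}\sigma^{\frac{n-1}{2}+\gamma+m}\log(\sigma)^k\,A_{m,k}\Big(\frac{s}{|s|}\theta;\gamma,\ell\Big),$$ $$A_{m,k}(\theta;\gamma,\ell)=\binom{\ell}{k}\sum_{p=0}^m A_p(\theta)\binom{m-1}{p-1}\,\frac{\partial^{\ell-k}}{\partial\eta^{\ell-k}}\Big|_{\eta=\gamma}B\Big(\eta+1,\frac{n-1}{2}+p\Big),$$ where $B(\alpha,\beta)=\int_0^1x^{\alpha-1}(1-x)^{\beta-1}dx$ and $\binom{j}{-1}$ is $1$ if $j=-1$ and $0$ otherwise. Here $\sim$ means the following, near each of the two boundary components $s=\pm1$ of $[-1,1]\times S^{n-1}$, with coordinates $(\sigma,\theta)$, $s=\pm\sqrt{1-\sigma}$: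 the coefficients are smooth in $\theta$ and there is $\varepsilon\in(0,1)$ such that for all $N\in\mathbb{N}_0$ and all real $t<\frac{n-1}{2}+\operatorname{Re}\gamma+N$, the difference of $Ru$ and the sum of the terms with $m<N$ belongs to $\mathcal{A}^t([0,\varepsilon)_\sigma\times S^{n-1})$. The class $\mathcal{A}^t([0,\varepsilon)\times S^{n-1})$ consists of the functions $f$ that are smooth on $(0,\varepsilon)\times S^{n-1}$ and such that, for any $k\ge 0$ and any $b$-vector fields $V_1,\dots,V_k$ on $[0,\varepsilon)\times S^{n-1}$ (vector fields $\alpha\,\sigma\partial_\sigma+Y$ with $\alpha$ and $Y$ smooth up to $\sigma=0$ and $Y$ tangent to $S^{n-1}$), $V_1\cdots V_kf=O(\sigma^t)$ locally uniformly on $[0,\varepsilon)\times S^{n-1}$. -/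

import Mathlib

open scoped Manifold ContDiff

noncomputable section

/-! ### Conormal functions and expansions at the boundary of `[0, ε) × W` -/

section Conormal

variable {F H W : Type*} [NormedAddCommGroup F] [NormedSpace ℝ F] [TopologicalSpace H]
  (I : ModelWithCorners ℝ F H) [TopologicalSpace W] [ChartedSpace H W] [IsManifold I 1 W]

/-- `X` is a vector field on `[0, ε) × W`, smooth up to the boundary `{0} × W`. -/
def IsSmoothField (ε : ℝ)
    (X : (p : ℝ × W) → TangentSpace (𝓘(ℝ, ℝ).prod I) p) : Prop :=
  ContMDiffOn (𝓘(ℝ, ℝ).prod I) (𝓘(ℝ, ℝ).prod I).tangent ∞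
    (fun p => (⟨p, X p⟩ : TangentBundle (𝓘(ℝ, ℝ).prod I) (ℝ × W)))
    (Set.Ico 0 ε ×ˢ (Set.univ : Set W))

/-- For `X = α ∂_σ + Y` (`Y` tangent to `W`), the derivative of `f` along the `b`-vector field
`α σ ∂_σ + Y`. When `X` runs over the smooth fields, these are all the `b`-vector fields: the
`C^∞`-span of `σ ∂_σ, ∂_{y_1}, …, ∂_{y_{dim W}}`. -/
def bDeriv (X : (p : ℝ × W) → TangentSpace (𝓘(ℝ, ℝ).prod I) p) (f : ℝ × W → ℂ) : ℝ × W → ℂ :=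
  fun p =>
    let v : ℝ × F := X p
    let w : ℝ × F := (p.1 * v.1, v.2)
    mfderiv (𝓘(ℝ, ℝ).prod I) 𝓘(ℝ, ℂ) f p w

/-- The conormal class `𝒜^t([0, ε) × W)`: `f` is smooth on `(0, ε) × W`, and every iterated
derivative `V_1 ⋯ V_k f` along `b`-vector fields is `O(σ^t)`, locally uniformly on
`[0, ε) × W`. -/
def IsConormal (ε t : ℝ) (f : ℝ × W → ℂ) : Prop :=
  ContMDiffOn (𝓘(ℝ, ℝ).prod I) 𝓘(ℝ, ℂ) ∞ f (Set.Ioo 0 ε ×ˢ (Set.univ : Set W)) ∧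
  ∀ L : List ((p : ℝ × W) → TangentSpace (𝓘(ℝ, ℝ).prod I) p), (∀ X ∈ L, IsSmoothField I ε X) →
    ∀ K : Set (ℝ × W), IsCompact K → K ⊆ Set.Ico 0 ε ×ˢ (Set.univ : Set W) →
      ∃ C : ℝ, ∀ p ∈ K, 0 < p.1 → ‖L.foldr (bDeriv I) f p‖ ≤ C * p.1 ^ t

/-- The asymptotic equivalence
`f(σ, y) ∼ ∑_{m ≥ 0} ∑_{k ≤ ℓ} σ^(z + m) log(σ)^k c m k y` near `σ = 0`: on some collar
`[0, ε) × W`, for every weight `t`, the remainder after subtracting all the terms with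
`m < N` is in `𝒜^t` as soon as every term that is left out (`m ≥ N`) has an exponent of real
part larger than `t`. -/
def HasPhgExpansion (f : ℝ × W → ℂ) (z : ℂ) (ℓ : ℕ) (c : ℕ → ℕ → W → ℂ) : Prop :=
  (∀ m, ∀ k ≤ ℓ, ContMDiff I 𝓘(ℝ, ℂ) ∞ (c m k)) ∧
  ∃ ε : ℝ, 0 < ε ∧ ε < 1 ∧ ∀ (t : ℝ) (N : ℕ), t < z.re + N →
    IsConormal I ε t (fun p => f p -
      ∑ m ∈ Finset.range N, ∑ k ∈ Finset.range (ℓ + 1),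
        (p.1 : ℂ) ^ (z + m) * (Real.log p.1 : ℂ) ^ k * c m k p.2)

end Conormal

/-! ### The Radon transform and the polyhomogeneous components on the ball

The ambient dimension is `n = d + 1`. -/

/-- Euclidean space of dimension `n = d + 1`. -/
abbrev Euc (d : ℕ) : Type := EuclideanSpace ℝ (Fin (d + 1))

/-- The unit sphere `S^{n-1}`, which is also the boundary of the unit ball. -/
abbrev Sph (d : ℕ) : Type := Metric.sphere (0 : Euc d) 1

variable {d : ℕ}

/-- The hyperplane `θ^⊥`. -/
abbrev perp (θ : Sph d) : Submodule ℝ (Euc d) := (ℝ ∙ (θ : Euc d))ᗮ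

/-- The Radon transform: the integral of `u` over the hyperplane `s θ + θ^⊥` for its
`(n-1)`-dimensional Lebesgue measure. -/
def radonTransform (u : Euc d → ℂ) (s : ℝ) (θ : Sph d) : ℂ :=
  ∫ y : perp θ, u (s • (θ : Euc d) + (y : Euc d))

/-- The radial extension `x ↦ a (x / |x|)` of a function on the sphere (the value at the origin
is irrelevant, and set to `0`). -/
def radialExt (a : Sph d → ℂ) (x : Euc d) : ℂ :=
  if h : x = 0 then 0
  else a ⟨‖x‖⁻¹ • x, by simp [norm_smul, inv_mul_cancel₀ (norm_ne_zero_iff.mpr h)]⟩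

/-- The component `a(x/|x|) ρ^γ log(ρ)^ℓ χ(ρ)`, `ρ = 1 - |x|²`, on the open unit ball, extended
by zero. -/
def phgComponent (a : Sph d → ℂ) (γ : ℂ) (ℓ : ℕ) (χ : ℝ → ℝ) (x : Euc d) : ℂ :=
  if ‖x‖ < 1 then
    radialExt a x * ((1 - ‖x‖ ^ 2 : ℝ) : ℂ) ^ γ * (Real.log (1 - ‖x‖ ^ 2) : ℂ) ^ ℓ *
      (χ (1 - ‖x‖ ^ 2) : ℂ)
  else 0

/-- `χ ∈ C_c^∞[0, 1)` with `χ = 1` near `0`; the values at negative arguments are irrelevant. -/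
structure IsCutoff (χ : ℝ → ℝ) : Prop where
  smooth : ContDiffOn ℝ ∞ χ (Set.Ico 0 1)
  eq_one : ∃ δ > 0, ∀ t ∈ Set.Icc 0 δ, χ t = 1
  eq_zero : ∃ c < 1, ∀ t, c ≤ t → χ t = 0

/-- The integral over the fibre sphere,
`F(q; θ) = ∫_{S^{n-1} ∩ θ^⊥} a((θ + q φ) / (1 + q²)^{1/2}) dφ`, for the surface measure of the
unit sphere of `θ^⊥` (the counting measure of two points if `n = 2`);
note that `|θ + q φ| = (1 + q²)^{1/2}`. -/
def fiberIntegral (a : Sph d → ℂ) (θ : Sph d) (q : ℝ) : ℂ :=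
  ∫ φ : Metric.sphere (0 : perp θ) 1,
    radialExt a ((θ : Euc d) + q • ((φ : perp θ) : Euc d))
      ∂((MeasureTheory.volume : MeasureTheory.Measure (perp θ)).toSphere)

/-- `A_p(θ)`: one half of the coefficient of `q^{2p}` in the Taylor expansion of `F(q; θ)` at
`q = 0`. The half is the Jacobian factor of the substitution `u = τ²`, `dτ = u^{-1/2} du / 2`. -/
def fiberCoeff (a : Sph d → ℂ) (p : ℕ) (θ : Sph d) : ℂ :=
  (1 / 2) * (iteratedDeriv (2 * p) (fiberIntegral a θ) 0 / ((2 * p).factorial : ℂ))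

/-- `chooseSub m p` is the binomial coefficient `(m - 1).choose (p - 1)` for `p ≤ m`, with the
convention that `j.choose (-1)` is `1` if `j = -1` and `0` otherwise. -/
def chooseSub : ℕ → ℕ → ℕ
  | 0, 0 => 1
  | _ + 1, 0 => 0
  | 0, _ + 1 => 0
  | m + 1, p + 1 => m.choose p

/-- The coefficient `A_{m,k}(θ; γ, ℓ)`, formed from the functions `A_p`. -/
def radonCoeff (A : ℕ → Sph d → ℂ) (γ : ℂ) (ℓ m k : ℕ) (θ : Sph d) : ℂ :=
  (ℓ.choose k : ℂ) * ∑ p ∈ Finset.range (m + 1), A p θ * (chooseSub m p : ℂ) *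
    iteratedDeriv (ℓ - k) (fun η : ℂ => Complex.betaIntegral (η + 1) ((d : ℂ) / 2 + p)) γ

end

/-! For `0 < s`, polar coordinates `y = r φ` on `θ^⊥` separate the integrand: the profile depends on
`r` alone, and since the angular factor is homogeneous of degree zero, its integral over the sphere
is `F(r/s; θ)`. After `r = √σ t` the argument of the profile is `σ (1 - t²)`, whose powers factor
and whose logarithm is `log σ + log (1 - t²)`. Where `χ = 1`, the binomial theorem writes the
transform as `∑ binom(ℓ,k) σ^(d/2+γ) log(σ)^k` times `∫₀¹ t^(d-1) (1-t²)^γ log(1-t²)^(ℓ-k) F(√σ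
t/√(1-σ); θ) dt` (`radonTransform_eq_sum`).

The function `F` is smooth and even in `q`. Its Taylor formula produces `(σ/(1-σ))^p t^(2p)`. The
moments in `t` are halves of derivatives of the Beta function (`integral_radialWeight`), and
expanding `(σ/(1-σ))^p` in powers of `σ` brings in the binomials `chooseSub m p`. This yields the
coefficients, with a remainder `σ^N` times a function smooth in `(√σ, θ)`
(`exists_radonLogCoeff_expansion`).

Such remainders are conormal: finite sums of terms `σ^w log(σ)^k h_k(√σ, θ)` are stable under
`b`-vector fields, because `σ ∂_σ = (1/2) r ∂_r` for `r = √σ`, and they are `O(σ^t)` for `t < Re w`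
(`IsLogSmooth.isConormal`). The boundary component `s = -1` follows from the symmetry `(s, θ) ↦ (-s,
-θ)`.

Smoothness of `F` jointly in `(q, θ)` requires a fixed domain of integration. An isometry `θ₀^⊥ →
θ^⊥`, depending smoothly on `θ` near `θ₀`, provides it. Functions on the sphere are extended
radially to the punctured space, so that calculus takes place in vector spaces. -/

open scoped Manifold ContDiff
open MeasureTheory Set Filter Topology

/-! ### Smooth dependence of integrals on parameters. -/

section ParametricIntegral

universe u

/-- Source of the dominating functions below: a constant that is local in the parameter but uniform
over the compact range of the integration variable. -/
theorem exists_ball_bound_of_continuousOn {E P : Type*} [NormedAddCommGroup E] [NormedSpace ℝ E]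
    [FiniteDimensional ℝ E] [NormedAddCommGroup P] {F : Type*} [NormedAddCommGroup F]
    {U : Set E} (hU : IsOpen U) {g : E × P → F} (hg : ContinuousOn g (U ×ˢ univ))
    {K : Set P} (hK : IsCompact K) {x₀ : E} (hx₀ : x₀ ∈ U) :
    ∃ δ > 0, Metric.ball x₀ δ ⊆ U ∧ ∃ C, ∀ x ∈ Metric.ball x₀ δ, ∀ p ∈ K, ‖g (x, p)‖ ≤ C := by
  obtain ⟨δ, hδ, hsub⟩ := Metric.nhds_basis_closedBall.mem_iff.1 (hU.mem_nhds hx₀)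
  have : ProperSpace E := FiniteDimensional.proper ℝ E
  obtain ⟨C, hC⟩ := ((isCompact_closedBall x₀ δ).prod hK).exists_bound_of_continuousOn
    (hg.mono (prod_mono hsub (subset_univ K)))
  exact ⟨δ, hδ, Metric.ball_subset_closedBall.trans hsub, C, fun x hx p hp =>
    hC (x, p) ⟨Metric.ball_subset_closedBall hx, hp⟩⟩

theorem aestronglyMeasurable_weight_smul {α E P : Type*} [MeasurableSpace α] {μ : Measure α}
    [NormedAddCommGroup E] [NormedAddCommGroup P] {F : Type*} [NormedAddCommGroup F] [NormedSpace ℂ F]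
    {w : α → ℂ} (hw : Integrable w μ) {π : α → P} (hπ : AEStronglyMeasurable π μ)
    {U : Set E} {g : E × P → F} (hg : ContinuousOn g (U ×ˢ univ)) {x : E} (hx : x ∈ U) :
    AEStronglyMeasurable (fun a => w a • g (x, π a)) μ := by
  refine hw.aestronglyMeasurable.smul ?_
  have : Continuous fun p => g (x, p) := by
    rw [← continuousOn_univ]
    exact hg.comp (by fun_prop) fun p _ => ⟨hx, mem_univ p⟩
  exact this.comp_aestronglyMeasurable hπ

theorem continuousOn_integral_weight_smul {α E P : Type*} [MeasurableSpace α] {μ : Measure α}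
    [NormedAddCommGroup E] [NormedSpace ℝ E] [FiniteDimensional ℝ E] [NormedAddCommGroup P] {F : Type*} [NormedAddCommGroup F] [NormedSpace ℝ F]
    [NormedSpace ℂ F]
    {w : α → ℂ} (hw : Integrable w μ) {π : α → P} (hπ : AEStronglyMeasurable π μ)
    {K : Set P} (hK : IsCompact K) (hπK : ∀ᵐ a ∂μ, π a ∈ K)
    {U : Set E} (hU : IsOpen U) {g : E × P → F} (hg : ContinuousOn g (U ×ˢ univ)) :
    ContinuousOn (fun x => ∫ a, w a • g (x, π a) ∂μ) U := by
  intro x₀ hx₀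
  obtain ⟨δ, hδ, hsub, C, hC⟩ := exists_ball_bound_of_continuousOn hU hg hK hx₀
  have hball : Metric.ball x₀ δ ∈ 𝓝 x₀ := Metric.ball_mem_nhds _ hδ
  refine ContinuousAt.continuousWithinAt ?_
  refine continuousAt_of_dominated (bound := fun a => ‖w a‖ * C) ?_ ?_ (hw.norm.mul_const C) ?_
  · filter_upwards [hball] with x hx
    exact aestronglyMeasurable_weight_smul hw hπ hg (hsub hx)
  · filter_upwards [hball] with x hx
    filter_upwards [hπK] with a ha
    rw [norm_smul]
    exact mul_le_mul_of_nonneg_left (hC x hx _ ha) (norm_nonneg _)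
  · refine Eventually.of_forall fun a => ?_
    have h1 : ContinuousAt g (x₀, π a) :=
      hg.continuousAt ((hU.prod isOpen_univ).mem_nhds ⟨hx₀, mem_univ _⟩)
    exact (ContinuousAt.comp (f := fun x => (x, π a)) h1 (by fun_prop)).const_smul (w a)

theorem hasFDerivAt_integral_weight_smul {α E P : Type*} [MeasurableSpace α] {μ : Measure α}
    [NormedAddCommGroup E] [NormedSpace ℝ E] [FiniteDimensional ℝ E]
    [NormedAddCommGroup P] [NormedSpace ℝ P] {F : Type*} [NormedAddCommGroup F] [NormedSpace ℝ F]
    [NormedSpace ℂ F] [IsScalarTower ℝ ℂ F]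
    {w : α → ℂ} (hw : Integrable w μ) {π : α → P} (hπ : AEStronglyMeasurable π μ)
    {K : Set P} (hK : IsCompact K) (hπK : ∀ᵐ a ∂μ, π a ∈ K)
    {U : Set E} (hU : IsOpen U) {g : E × P → F} (hg : ContDiffOn ℝ 1 g (U ×ˢ univ))
    {x₀ : E} (hx₀ : x₀ ∈ U) :
    HasFDerivAt (fun x => ∫ a, w a • g (x, π a) ∂μ)
      (∫ a, w a • (fderiv ℝ g (x₀, π a)).comp (ContinuousLinearMap.inl ℝ E P) ∂μ) x₀ := by
  have hopen : IsOpen (U ×ˢ (univ : Set P)) := hU.prod isOpen_univ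
  have hg' : ContinuousOn
      (fun q => (fderiv ℝ g q).comp (ContinuousLinearMap.inl ℝ E P)) (U ×ˢ univ) :=
    (hg.continuousOn_fderiv_of_isOpen hopen le_rfl).clm_comp continuousOn_const
  obtain ⟨δ, hδ, hsub, C, hC⟩ := exists_ball_bound_of_continuousOn hU hg' hK hx₀
  obtain ⟨δ', hδ', hsub', C', hC'⟩ :=
    exists_ball_bound_of_continuousOn hU hg.continuousOn hK hx₀
  have hball : Metric.ball x₀ δ ∈ 𝓝 x₀ := Metric.ball_mem_nhds _ hδ
  refine hasFDerivAt_integral_of_dominated_of_fderiv_le (bound := fun a => ‖w a‖ * C) hball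
    (F' := fun x a => w a • (fderiv ℝ g (x, π a)).comp (ContinuousLinearMap.inl ℝ E P))
    ?_ ?_ ?_ ?_ (hw.norm.mul_const C) ?_
  · filter_upwards [hball] with x hx
    exact aestronglyMeasurable_weight_smul hw hπ hg.continuousOn (hsub hx)
  · refine Integrable.mono' (hw.norm.mul_const C')
      (aestronglyMeasurable_weight_smul hw hπ hg.continuousOn hx₀) ?_
    filter_upwards [hπK] with a ha
    rw [norm_smul]
    exact mul_le_mul_of_nonneg_left (hC' x₀ (Metric.mem_ball_self hδ') _ ha) (norm_nonneg _)
  · exact aestronglyMeasurable_weight_smul hw hπ hg' hx₀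
  · filter_upwards [hπK] with a ha x hx
    rw [norm_smul]
    exact mul_le_mul_of_nonneg_left (hC x hx _ ha) (norm_nonneg _)
  · refine Eventually.of_forall fun a x hx => ?_
    have h1 : HasFDerivAt g (fderiv ℝ g (x, π a)) (x, π a) :=
      ((hg.differentiableOn one_ne_zero).differentiableAt
        (hopen.mem_nhds ⟨hsub hx, mem_univ _⟩)).hasFDerivAt
    exact (h1.comp x (hasFDerivAt_prodMk_left x (π a))).const_smul (w a)

/-- Each differentiation under the integral replaces the target `F` by `E →L[ℝ] F`, so the induction
runs over all targets. `E` and `F` share a universe so that the new target is again admissible. -/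
theorem contDiffOn_nat_integral_weight_smul {α : Type*} [MeasurableSpace α] {μ : Measure α}
    {E : Type u} {P : Type*} [NormedAddCommGroup E] [NormedSpace ℝ E] [FiniteDimensional ℝ E]
    [NormedAddCommGroup P] [NormedSpace ℝ P]
    {w : α → ℂ} (hw : Integrable w μ) {π : α → P} (hπ : AEStronglyMeasurable π μ)
    {K : Set P} (hK : IsCompact K) (hπK : ∀ᵐ a ∂μ, π a ∈ K)
    {U : Set E} (hU : IsOpen U) (n : ℕ) : ∀ {F : Type u} [NormedAddCommGroup F] [NormedSpace ℝ F]
    [NormedSpace ℂ F] [IsScalarTower ℝ ℂ F] {g : E × P → F}, ContDiffOn ℝ n g (U ×ˢ univ) →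
    ContDiffOn ℝ n (fun x => ∫ a, w a • g (x, π a) ∂μ) U := by
  induction n with
  | zero =>
    intro F _ _ _ _ g hg
    rw [Nat.cast_zero, contDiffOn_zero] at hg ⊢
    exact continuousOn_integral_weight_smul hw hπ hK hπK hU hg
  | succ n ih =>
    intro F _ _ _ _ g hg
    have hopen : IsOpen (U ×ˢ (univ : Set P)) := hU.prod isOpen_univ
    have hd := fun x₀ (hx₀ : x₀ ∈ U) => hasFDerivAt_integral_weight_smul hw hπ hK hπK hU
      (hg.of_le (by exact_mod_cast Nat.le_add_left 1 n)) hx₀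
    have hg1 := hg
    push_cast at hg1 ⊢
    rw [contDiffOn_succ_iff_fderiv_of_isOpen hopen] at hg1
    rw [contDiffOn_succ_iff_fderiv_of_isOpen hU]
    refine ⟨fun x hx => (hd x hx).differentiableAt.differentiableWithinAt, by simp, ?_⟩
    refine (ih (g := fun q => (fderiv ℝ g q).comp (ContinuousLinearMap.inl ℝ E P))
      (hg1.2.2.clm_comp contDiffOn_const)).congr fun x hx => (hd x hx).fderiv

/-- Smoothness of `x ↦ ∫ w(a) g(x, π(a)) dμ(a)` for an integrable weight `w`, a map `π` with values
in a compact set, and `g` smooth jointly in both variables. -/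
theorem contDiffOn_integral_weight_smul {α : Type*} [MeasurableSpace α] {μ : Measure α}
    {E : Type u} {P : Type*} [NormedAddCommGroup E] [NormedSpace ℝ E] [FiniteDimensional ℝ E]
    [NormedAddCommGroup P] [NormedSpace ℝ P] {F : Type u} [NormedAddCommGroup F] [NormedSpace ℝ F]
    [NormedSpace ℂ F] [IsScalarTower ℝ ℂ F]
    {w : α → ℂ} (hw : Integrable w μ) {π : α → P} (hπ : AEStronglyMeasurable π μ)
    {K : Set P} (hK : IsCompact K) (hπK : ∀ᵐ a ∂μ, π a ∈ K)
    {U : Set E} (hU : IsOpen U) {g : E × P → F} (hg : ContDiffOn ℝ ∞ g (U ×ˢ univ)) :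
    ContDiffOn ℝ ∞ (fun x => ∫ a, w a • g (x, π a) ∂μ) U := by
  rw [contDiffOn_infty] at hg ⊢
  exact fun n => contDiffOn_nat_integral_weight_smul hw hπ hK hπK hU n (hg n)

end ParametricIntegral

/-! ### Smooth maps into the sphere. -/

section SphereMaps

open Metric Module

variable {E : Type*} [NormedAddCommGroup E] [InnerProductSpace ℝ E]
  {m : ℕ∞ω} {F : Type*} [NormedAddCommGroup F] [NormedSpace ℝ F]
  {H : Type*} [TopologicalSpace H] {I : ModelWithCorners ℝ F H}
  {M : Type*} [TopologicalSpace M] [ChartedSpace H M] [IsManifold I m M]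

/-- A map into the sphere is smooth on a set if it is so as a map into the ambient space. -/
theorem ContMDiffOn.of_coe_sphere {n : ℕ} [Fact (finrank ℝ E = n + 1)]
    {f : M → sphere (0 : E) 1} {s : Set M}
    (hf : ContMDiffOn I 𝓘(ℝ, E) m (fun x => (f x : E)) s) :
    ContMDiffOn I (𝓡 n) m f s := by
  rw [contMDiffOn_iff_target]
  refine ⟨continuousOn_iff_continuous_domRestrict.2
    (continuous_induced_rng.2 (continuousOn_iff_continuous_domRestrict.1 hf.continuousOn)), ?_⟩
  intro v
  let U : _ ≃ₗᵢ[ℝ] _ :=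
    (OrthonormalBasis.fromOrthogonalSpanSingleton
        n (ne_zero_of_mem_unit_sphere (-v))).repr
  have h : ContDiffOn ℝ ω _ Set.univ := U.contDiff.contDiffOn
  have H₁ := (h.comp_inter contDiffOn_stereoToFun).contMDiffOn
  convert! (H₁.of_le le_top).comp' hf using 1
  ext x
  have hfxv : (f x : E) = -↑v ↔ inner ℝ (f x : E) (-(v : E)) = 1 := by
    have hfx : ‖(f x : E)‖ = 1 := by simp
    rw [inner_eq_one_iff_of_norm_eq_one hfx]
    exact norm_eq_of_mem_sphere (-v)
  simp [chartAt, ChartedSpace.chartAt, Subtype.ext_iff, hfxv, real_inner_comm]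

end SphereMaps

/-! ### Radial extension: from the sphere to the punctured space and back. -/

section RadialProjection

variable {d : ℕ}

/-- The radial projection of the punctured space onto the sphere, with an arbitrary value at the
origin. -/
noncomputable def sphProj (x : Euc d) : Sph d :=
  if h : x = 0 then ⟨EuclideanSpace.single 0 1, by simp⟩
  else ⟨‖x‖⁻¹ • x, by simp [norm_smul, inv_mul_cancel₀ (norm_ne_zero_iff.mpr h)]⟩

theorem coe_sphProj {x : Euc d} (hx : x ≠ 0) : (sphProj x : Euc d) = ‖x‖⁻¹ • x := by
  simp [sphProj, hx]

theorem sphProj_coe (θ : Sph d) : sphProj (θ : Euc d) = θ := by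
  have hθ : (θ : Euc d) ≠ 0 := ne_zero_of_mem_unit_sphere θ
  apply Subtype.ext
  rw [coe_sphProj hθ]
  simp

theorem sphProj_smul {c : ℝ} (hc : 0 < c) (x : Euc d) : sphProj (c • x) = sphProj x := by
  by_cases hx : x = 0
  · simp [hx]
  · apply Subtype.ext
    rw [coe_sphProj hx, coe_sphProj (smul_ne_zero hc.ne' hx), norm_smul, Real.norm_of_nonneg hc.le,
      smul_smul, mul_inv, mul_right_comm, inv_mul_cancel₀ hc.ne', one_mul]

theorem contDiffOn_coe_sphProj :
    ContDiffOn ℝ ∞ (fun x : Euc d => (sphProj x : Euc d)) {0}ᶜ := by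
  have h : ContDiffOn ℝ ∞ (fun x : Euc d => ‖x‖⁻¹ • x) {0}ᶜ := by
    refine ContDiffOn.smul (ContDiffOn.inv ?_ fun x hx => norm_ne_zero_iff.2 hx) contDiffOn_id
    exact fun x hx => (contDiffAt_norm ℝ hx).contDiffWithinAt
  exact h.congr fun x hx => coe_sphProj hx

theorem contMDiffOn_sphProj :
    ContMDiffOn 𝓘(ℝ, Euc d) (𝓡 d) ∞ (sphProj : Euc d → Sph d) {0}ᶜ :=
  haveI := Fact.mk (@finrank_euclideanSpace_fin ℝ _ (d + 1))
  ContMDiffOn.of_coe_sphere contDiffOn_coe_sphProj.contMDiffOn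

theorem contMDiff_coe_sph : ContMDiff (𝓡 d) 𝓘(ℝ, Euc d) ∞ (fun θ : Sph d => (θ : Euc d)) :=
  haveI := Fact.mk (@finrank_euclideanSpace_fin ℝ _ (d + 1))
  contMDiff_coe_sphere

theorem radialExt_eq {a : Sph d → ℂ} {x : Euc d} (hx : x ≠ 0) :
    radialExt a x = a (sphProj x) := by
  simp [radialExt, sphProj, hx]

theorem radialExt_smul (a : Sph d → ℂ) {c : ℝ} (hc : 0 < c) (x : Euc d) :
    radialExt a (c • x) = radialExt a x := by
  by_cases hx : x = 0
  · simp [hx]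
  · rw [radialExt_eq hx, radialExt_eq (smul_ne_zero hc.ne' hx), sphProj_smul hc]

theorem contDiffOn_radialExt {a : Sph d → ℂ} (ha : ContMDiff (𝓡 d) 𝓘(ℝ, ℂ) ∞ a) :
    ContDiffOn ℝ ∞ (radialExt a) {0}ᶜ :=
  ((ha.comp_contMDiffOn contMDiffOn_sphProj).contDiffOn).congr fun _ hx => radialExt_eq hx

/-- The radial extension of a function that is smooth on `s × S^d`. -/
theorem contDiffOn_radial_prod {E : Type*} [NormedAddCommGroup E] [NormedSpace ℝ E]
    {s : Set ℝ} {g : ℝ × Sph d → E}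
    (hg : ContMDiffOn (𝓘(ℝ, ℝ).prod (𝓡 d)) 𝓘(ℝ, E) ∞ g (s ×ˢ univ)) :
    ContDiffOn ℝ ∞ (fun q : ℝ × Euc d => g (q.1, sphProj q.2)) (s ×ˢ {0}ᶜ) := by
  rw [← contMDiffOn_iff_contDiffOn]
  refine hg.comp (t := s ×ˢ univ) (f := fun q : ℝ × Euc d => (q.1, sphProj q.2)) ?_
    fun q hq => ⟨hq.1, mem_univ _⟩
  refine ContMDiffOn.prodMk contDiff_fst.contMDiff.contMDiffOn ?_
  exact contMDiffOn_sphProj.comp (t := {0}ᶜ) contDiff_snd.contMDiff.contMDiffOn fun q hq => hq.2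

theorem contMDiff_of_contDiffOn_compl_zero {E : Type*} [NormedAddCommGroup E] [NormedSpace ℝ E]
    {g : Euc d → E} (hg : ContDiffOn ℝ ∞ g {0}ᶜ) :
    ContMDiff (𝓡 d) 𝓘(ℝ, E) ∞ (fun θ : Sph d => g θ) := by
  rw [← contMDiffOn_univ]
  exact hg.contMDiffOn.comp contMDiff_coe_sph.contMDiffOn
    fun θ _ => ne_zero_of_mem_unit_sphere θ

/-- The inclusion of `ℝ × S^d` into `ℝ × ℝ^{d+1}`. -/
def prodCoe (p : ℝ × Sph d) : ℝ × Euc d := (p.1, (p.2 : Euc d))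

theorem contMDiff_prodCoe :
    ContMDiff (𝓘(ℝ, ℝ).prod (𝓡 d)) 𝓘(ℝ, ℝ × Euc d) ∞ (prodCoe (d := d)) :=
  contMDiff_fst.prodMk_space (contMDiff_coe_sph.comp contMDiff_snd)

theorem contMDiffOn_comp_prodCoe {E : Type*} [NormedAddCommGroup E] [NormedSpace ℝ E]
    {s : Set ℝ} {g : ℝ × Euc d → E} (hg : ContDiffOn ℝ ∞ g (s ×ˢ {0}ᶜ)) :
    ContMDiffOn (𝓘(ℝ, ℝ).prod (𝓡 d)) 𝓘(ℝ, E) ∞ (fun p => g (prodCoe p)) (s ×ˢ univ) :=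
  hg.contMDiffOn.comp contMDiff_prodCoe.contMDiffOn
    fun p hp => ⟨hp.1, ne_zero_of_mem_unit_sphere p.2⟩

end RadialProjection

/-! ### A class of log-smooth functions contained in the conormal classes. -/

section LogSmooth

variable {d : ℕ}

/-- Finite sums `∑ σ^w log(σ)^k h_k(√σ, θ)` with coefficients `h_k` that are smooth up to the
boundary and extended to the punctured ambient space. -/
def IsLogSmooth (ε : ℝ) (w : ℂ) (f : ℝ × Sph d → ℂ) : Prop :=
  ∃ (K : ℕ) (h : ℕ → ℝ × Euc d → ℂ),
    (∀ k, ContDiffOn ℝ ∞ (h k) (Ico 0 (√ε) ×ˢ {0}ᶜ)) ∧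
    ∀ p : ℝ × Sph d, p.1 ∈ Ioo 0 ε →
      f p = ∑ k ∈ Finset.range K,
        (p.1 : ℂ) ^ w * (Real.log p.1 : ℂ) ^ k * h k (√p.1, (p.2 : Euc d))

theorem sqrt_mem_Ioo {ε σ : ℝ} (hσ : σ ∈ Ioo 0 ε) : √σ ∈ Ioo 0 (√ε) :=
  ⟨Real.sqrt_pos.2 hσ.1, Real.sqrt_lt_sqrt hσ.1.le hσ.2⟩

theorem hasDerivAt_cpow_mul_log_pow (w : ℂ) (k : ℕ) {σ : ℝ} (hσ : 0 < σ) :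
    HasDerivAt (fun y : ℝ => (y : ℂ) ^ w * (Real.log y : ℂ) ^ k)
      ((σ : ℂ) ^ w * (w * (Real.log σ : ℂ) ^ k + k * (Real.log σ : ℂ) ^ (k - 1)) / σ) σ := by
  have hσ' : (σ : ℂ) ≠ 0 := by exact_mod_cast hσ.ne'
  have h1 : HasDerivAt (fun y : ℝ => (y : ℂ) ^ w) (w * (σ : ℂ) ^ (w - 1) * 1) σ :=
    ((hasDerivAt_id' (σ : ℂ)).cpow_const
      (Complex.ofReal_mem_slitPlane.2 hσ)).comp_ofReal
  have h2 : HasDerivAt (fun y : ℝ => (Real.log y : ℂ)) ((σ⁻¹ : ℝ) : ℂ) σ :=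
    (Real.hasDerivAt_log hσ.ne').ofReal_comp
  refine (h1.mul (h2.fun_pow k)).congr_deriv ?_
  rw [Complex.cpow_sub _ _ hσ', Complex.cpow_one]
  push_cast
  field_simp

theorem contDiffAt_cpow_mul_log_pow (w : ℂ) (k : ℕ) {σ : ℝ} (hσ : 0 < σ) :
    ContDiffAt ℝ ∞ (fun y : ℝ => (y : ℂ) ^ w * (Real.log y : ℂ) ^ k) σ := by
  refine ContDiffAt.mul ?_ (ContDiffAt.pow ?_ k)
  · have h1 : (fun y : ℝ => (y : ℂ) ^ w) =ᶠ[𝓝 σ]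
        fun y : ℝ => Complex.exp ((Real.log y : ℂ) * w) := by
      filter_upwards [Ioi_mem_nhds hσ] with y hy
      rw [Complex.cpow_def_of_ne_zero (by exact_mod_cast (ne_of_gt hy)),
        Complex.ofReal_log (le_of_lt hy)]
    refine ContDiffAt.congr_of_eventuallyEq ?_ h1
    exact (((Complex.ofRealCLM.contDiff.contDiffAt).comp σ
      (Real.contDiffAt_log.2 hσ.ne')).mul contDiffAt_const).cexp
  · exact (Complex.ofRealCLM.contDiff.contDiffAt).comp σ (Real.contDiffAt_log.2 hσ.ne')

theorem collar_mem_nhds {ε : ℝ} {q : ℝ × Euc d} (h1 : q.1 ∈ Ioo 0 ε) (h2 : q.2 ≠ 0) :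
    Ico 0 ε ×ˢ ({0}ᶜ : Set (Euc d)) ∈ 𝓝 q :=
  prod_mem_nhds (Ico_mem_nhds h1.1 h1.2) (isOpen_compl_singleton.mem_nhds h2)

theorem uniqueDiffOn_collar (ε : ℝ) : UniqueDiffOn ℝ (Ico 0 ε ×ˢ ({0}ᶜ : Set (Euc d))) :=
  (uniqueDiffOn_Ico 0 ε).prod isOpen_compl_singleton.uniqueDiffOn

theorem contDiffOn_logTerm {ε : ℝ} (w : ℂ) (k : ℕ) {h : ℝ × Euc d → ℂ}
    (hh : ContDiffOn ℝ ∞ h (Ico 0 (√ε) ×ˢ {0}ᶜ)) :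
    ContDiffOn ℝ ∞ (fun q : ℝ × Euc d =>
      (q.1 : ℂ) ^ w * (Real.log q.1 : ℂ) ^ k * h (√q.1, q.2)) (Ioo 0 ε ×ˢ {0}ᶜ) := by
  intro q hq
  refine ContDiffAt.contDiffWithinAt (ContDiffAt.mul ?_ ?_)
  · exact (contDiffAt_cpow_mul_log_pow w k hq.1.1).comp q contDiffAt_fst
  · refine ContDiffAt.comp (f := fun q : ℝ × Euc d => (√q.1, q.2)) q
      (hh.contDiffAt (collar_mem_nhds (sqrt_mem_Ioo hq.1) hq.2)) ?_
    exact (contDiffAt_fst.sqrt hq.1.1.ne').prodMk contDiffAt_snd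

/-- On functions of `r = √σ` the field `α σ ∂_σ` acts as `(α r / 2) ∂_r`, so no singularity appears
at `r = 0`. The derivative of `h` is taken within the collar because that version is smooth up to
the boundary. For `k = 0` the truncated exponent `k - 1` is harmless, its factor being zero. -/
theorem fderiv_logTerm {ε : ℝ} (w : ℂ) (k : ℕ) {h : ℝ × Euc d → ℂ}
    (hh : ContDiffOn ℝ ∞ h (Ico 0 (√ε) ×ˢ {0}ᶜ)) {q : ℝ × Euc d}
    (hq : q ∈ Ioo 0 ε ×ˢ ({0}ᶜ : Set (Euc d))) (α : ℝ) (y : Euc d) :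
    fderiv ℝ (fun q : ℝ × Euc d =>
      (q.1 : ℂ) ^ w * (Real.log q.1 : ℂ) ^ k * h (√q.1, q.2)) q (q.1 * α, y) =
    (q.1 : ℂ) ^ w * ((w * (Real.log q.1 : ℂ) ^ k + k * (Real.log q.1 : ℂ) ^ (k - 1)) *
      (α * h (√q.1, q.2)) + (Real.log q.1 : ℂ) ^ k *
      fderivWithin ℝ h (Ico 0 (√ε) ×ˢ {0}ᶜ) (√q.1, q.2) (√q.1 * α / 2, y)) := by
  have hσ : (q.1 : ℂ) ≠ 0 := by exact_mod_cast hq.1.1.ne'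
  have hs : √q.1 ≠ 0 := (Real.sqrt_pos.2 hq.1.1).ne'
  have hnhds := collar_mem_nhds (q := (√q.1, q.2)) (sqrt_mem_Ioo hq.1) hq.2
  have h1 : HasFDerivAt h (fderivWithin ℝ h (Ico 0 (√ε) ×ˢ {0}ᶜ) (√q.1, q.2)) (√q.1, q.2) := by
    rw [fderivWithin_of_mem_nhds hnhds]
    exact ((hh.contDiffAt hnhds).differentiableAt (by simp)).hasFDerivAt
  have h2 : HasFDerivAt (fun q : ℝ × Euc d => (√q.1, q.2)) _ q :=
    ((hasFDerivAt_fst (𝕜 := ℝ) (p := q)).sqrt hq.1.1.ne').prodMk hasFDerivAt_snd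
  have h3 := (hasDerivAt_cpow_mul_log_pow w k hq.1.1).hasFDerivAt.comp q
    (hasFDerivAt_fst (𝕜 := ℝ) (p := q))
  have h4 := h3.mul (h1.comp q h2)
  have h5 : √q.1 * α / 2 = 1 / (2 * √q.1) * (q.1 * α) := by
    nth_rewrite 3 [← Real.mul_self_sqrt hq.1.1.le]
    field_simp
  rw [show (fun q : ℝ × Euc d => (q.1 : ℂ) ^ w * (Real.log q.1 : ℂ) ^ k * h (√q.1, q.2)) =
    ((fun y : ℝ => (y : ℂ) ^ w * (Real.log y : ℂ) ^ k) ∘ Prod.fst) *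
      (h ∘ fun q : ℝ × Euc d => (√q.1, q.2)) from rfl, HasFDerivAt.fderiv h4, h5]
  simp
  field_simp
  ring

theorem IsLogSmooth.contMDiffOn {ε : ℝ} {w : ℂ} {f : ℝ × Sph d → ℂ} (hf : IsLogSmooth ε w f) :
    ContMDiffOn (𝓘(ℝ, ℝ).prod (𝓡 d)) 𝓘(ℝ, ℂ) ∞ f (Ioo 0 ε ×ˢ univ) := by
  obtain ⟨K, h, hh, hfh⟩ := hf
  have h1 : ContDiffOn ℝ ∞ (fun q : ℝ × Euc d => ∑ k ∈ Finset.range K,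
      (q.1 : ℂ) ^ w * (Real.log q.1 : ℂ) ^ k * h k (√q.1, q.2)) (Ioo 0 ε ×ˢ {0}ᶜ) :=
    ContDiffOn.sum fun k _ => contDiffOn_logTerm w k (hh k)
  exact (contMDiffOn_comp_prodCoe h1).congr fun p hp => hfh p hp.1

theorem hasMFDerivAt_prodCoe (p : ℝ × Sph d) :
    HasMFDerivAt (𝓘(ℝ, ℝ).prod (𝓡 d)) 𝓘(ℝ, ℝ × Euc d) (prodCoe (d := d)) p
      (mfderiv (𝓘(ℝ, ℝ).prod (𝓡 d)) 𝓘(ℝ, ℝ × Euc d) (prodCoe (d := d)) p) :=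
  ((contMDiff_prodCoe p).mdifferentiableAt (by simp)).hasMFDerivAt

/-- The `σ`-component is unchanged by the embedding, so the factor `σ` in `bDeriv` can be inserted
before or after pushing the field forward. -/
theorem mfderiv_prodCoe (p : ℝ × Sph d) (v : ℝ × EuclideanSpace ℝ (Fin d)) :
    mfderiv (𝓘(ℝ, ℝ).prod (𝓡 d)) 𝓘(ℝ, ℝ × Euc d) (prodCoe (d := d)) p v =
      (v.1, mfderiv (𝓡 d) 𝓘(ℝ, Euc d) (fun θ : Sph d => (θ : Euc d)) p.2 v.2) := by
  have h1 : HasMFDerivAt (𝓘(ℝ, ℝ).prod (𝓡 d)) 𝓘(ℝ, Euc d)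
      (fun p : ℝ × Sph d => (p.2 : Euc d)) p _ :=
    (((contMDiff_coe_sph (d := d) p.2).mdifferentiableAt (by simp)).hasMFDerivAt).comp p
      (hasMFDerivAt_snd p)
  have h2 := hasMFDerivAt_fst (I := 𝓘(ℝ, ℝ)) (I' := 𝓡 d) p
  have h3 : HasMFDerivAt (𝓘(ℝ, ℝ).prod (𝓡 d)) 𝓘(ℝ, ℝ × Euc d) (prodCoe (d := d)) p _ :=
    ⟨h2.1.prodMk h1.1, h2.2.prodMk h1.2⟩
  rw [h3.mfderiv]
  rfl

theorem contMDiffOn_mfderiv_prodCoe_field {ε : ℝ}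
    {X : (p : ℝ × Sph d) → TangentSpace (𝓘(ℝ, ℝ).prod (𝓡 d)) p}
    (hX : IsSmoothField (𝓡 d) ε X) :
    ContMDiffOn (𝓘(ℝ, ℝ).prod (𝓡 d)) 𝓘(ℝ, ℝ × Euc d) ∞
      (fun p => (mfderiv (𝓘(ℝ, ℝ).prod (𝓡 d)) 𝓘(ℝ, ℝ × Euc d) (prodCoe (d := d)) p (X p) :
        ℝ × Euc d)) (Ico 0 ε ×ˢ univ) := by
  have h1 : ContMDiff (𝓘(ℝ, ℝ).prod (𝓡 d)).tangent 𝓘(ℝ, ℝ × Euc d).tangent ∞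
      (tangentMap (𝓘(ℝ, ℝ).prod (𝓡 d)) 𝓘(ℝ, ℝ × Euc d) (prodCoe (d := d))) :=
    contMDiff_prodCoe.contMDiff_tangentMap (by simp)
  exact (contMDiff_snd_tangentBundle_modelSpace (ℝ × Euc d) 𝓘(ℝ, ℝ × Euc d)).comp_contMDiffOn
    (h1.comp_contMDiffOn hX)

theorem sum_range_nat_mul_pow_sub_one (K : ℕ) (L : ℂ) (h : ℕ → ℂ) :
    ∑ k ∈ Finset.range K, (k : ℂ) * L ^ (k - 1) * h k =
      ∑ k ∈ Finset.range K, L ^ k * (if k + 1 < K then ((k : ℂ) + 1) * h (k + 1) else 0) := by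
  cases K with
  | zero => simp
  | succ K =>
    rw [Finset.sum_range_succ', Finset.sum_range_succ]
    simp only [Nat.cast_zero, zero_mul, add_zero, lt_irrefl, if_false, mul_zero]
    refine Finset.sum_congr rfl fun k hk => ?_
    rw [if_pos (by simpa using hk)]
    push_cast
    ring

theorem IsLogSmooth.bDeriv_field {ε : ℝ} {w : ℂ} {f : ℝ × Sph d → ℂ} (hf : IsLogSmooth ε w f)
    {X : (p : ℝ × Sph d) → TangentSpace (𝓘(ℝ, ℝ).prod (𝓡 d)) p}
    (hX : IsSmoothField (𝓡 d) ε X) : IsLogSmooth ε w (bDeriv (𝓡 d) X f) := by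
  obtain ⟨K, h, hh, hfh⟩ := hf
  let V : ℝ × Sph d → ℝ × Euc d := fun p =>
    mfderiv (𝓘(ℝ, ℝ).prod (𝓡 d)) 𝓘(ℝ, ℝ × Euc d) (prodCoe (d := d)) p (X p)
  -- The components of the field in the variables `(r, x)`, `σ = r²`, extended radially; they stay
  -- smooth up to `r = 0`.
  let V' : ℝ × Euc d → ℝ × Euc d := fun q => V (q.1 ^ 2, sphProj q.2)
  have hV' : ContDiffOn ℝ ∞ V' (Ico 0 (√ε) ×ˢ {0}ᶜ) := by
    refine (contDiffOn_radial_prod (contMDiffOn_mfderiv_prodCoe_field hX)).comp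
      (f := fun q : ℝ × Euc d => (q.1 ^ 2, q.2)) (by fun_prop) ?_
    intro q hq
    refine ⟨⟨sq_nonneg _, ?_⟩, hq.2⟩
    exact (Real.lt_sqrt hq.1.1).1 hq.1.2
  let D : Set (ℝ × Euc d) := Ico 0 (√ε) ×ˢ {0}ᶜ
  -- The three contributions come from differentiating `σ^w`, the power of the logarithm, and `h k`.
  -- The second lowers the power by one, so it reaches index `k` from `k + 1`, if that index occurs.
  let h' : ℕ → ℝ × Euc d → ℂ := fun k q =>
    w * ((V' q).1 * h k q) +
      (if k + 1 < K then ((k : ℂ) + 1) * ((V' q).1 * h (k + 1) q) else 0) +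
      fderivWithin ℝ (h k) D q (q.1 * (V' q).1 / 2, (V' q).2)
  refine ⟨K, h', fun k => ?_, fun p hp => ?_⟩
  · have hα : ContDiffOn ℝ ∞ (fun q => ((V' q).1 : ℂ)) D :=
      Complex.ofRealCLM.contDiff.comp_contDiffOn (contDiff_fst.comp_contDiffOn hV')
    refine ContDiffOn.add (ContDiffOn.add (contDiffOn_const.mul (hα.mul (hh k))) ?_) ?_
    · split_ifs
      · exact contDiffOn_const.mul (hα.mul (hh (k + 1)))
      · exact contDiffOn_const
    · refine ((hh k).fderivWithin (uniqueDiffOn_collar _) (by simp)).clm_apply ?_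
      refine ContDiffOn.prodMk ?_ (contDiff_snd.comp_contDiffOn hV')
      exact (contDiffOn_fst.mul (contDiff_fst.comp_contDiffOn hV')).div_const 2
  · let g : ℝ × Euc d → ℂ := fun q => ∑ k ∈ Finset.range K,
      (q.1 : ℂ) ^ w * (Real.log q.1 : ℂ) ^ k * h k (√q.1, q.2)
    have hmem : prodCoe p ∈ Ioo 0 ε ×ˢ ({0}ᶜ : Set (Euc d)) :=
      ⟨hp, ne_zero_of_mem_unit_sphere p.2⟩
    have hopen : IsOpen (Ioo 0 ε ×ˢ ({0}ᶜ : Set (Euc d))) :=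
      isOpen_Ioo.prod isOpen_compl_singleton
    have hterm := fun k => ((contDiffOn_logTerm w k (hh k)).contDiffAt
      (hopen.mem_nhds hmem)).differentiableAt (by simp)
    have hg : DifferentiableAt ℝ g (prodCoe p) := DifferentiableAt.fun_sum fun k _ => hterm k
    have heq : f =ᶠ[𝓝 p] g ∘ prodCoe := by
      filter_upwards [prod_mem_nhds (Ioo_mem_nhds hp.1 hp.2) univ_mem] with p' hp'
      exact hfh p' hp'.1
    have hder : HasMFDerivAt (𝓘(ℝ, ℝ).prod (𝓡 d)) 𝓘(ℝ, ℂ) f p _ :=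
      (hg.hasFDerivAt.hasMFDerivAt.comp p (hasMFDerivAt_prodCoe p)).congr_of_eventuallyEq heq
    have hb : bDeriv (𝓡 d) X f p = fderiv ℝ g (prodCoe p) (p.1 * (V p).1, (V p).2) := by
      have hV : V p = ((X p : ℝ × EuclideanSpace ℝ (Fin d)).1,
        mfderiv (𝓡 d) 𝓘(ℝ, Euc d) (fun θ : Sph d => (θ : Euc d)) p.2
          (X p : ℝ × EuclideanSpace ℝ (Fin d)).2) := mfderiv_prodCoe p (X p)
      rw [hV]
      simp only [bDeriv]
      rw [hder.mfderiv]
      exact congrArg (fderiv ℝ g (prodCoe p)) (mfderiv_prodCoe p _)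
    have hVp : V' (√p.1, (p.2 : Euc d)) = V p := by
      simp only [V', sphProj_coe, Real.sq_sqrt hp.1.le]
    rw [hb, fderiv_fun_sum fun k _ => hterm k, sum_apply]
    simp only [h', hVp]
    have := fun k => fderiv_logTerm w k (hh k) hmem (V p).1 (V p).2
    simp only [prodCoe] at this
    simp only [prodCoe, this]
    simp only [mul_add, add_mul, Finset.sum_add_distrib, mul_assoc]
    congr 1
    · congr 1
      · refine Finset.sum_congr rfl fun k _ => by ring
      · rw [← Finset.mul_sum, ← Finset.mul_sum]
        simp only [← mul_assoc]
        have := sum_range_nat_mul_pow_sub_one K (Real.log p.1 : ℂ)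
          (fun k => (V p).1 * h k (√p.1, (p.2 : Euc d)))
        simp only [← mul_assoc] at this
        rw [this]
        simp only [add_mul]

theorem exists_rpow_mul_log_pow_le (k : ℕ) {s : ℝ} (hs : 0 < s) :
    ∃ B : ℝ, ∀ x : ℝ, 0 < x → x ≤ 1 → x ^ s * |Real.log x| ^ k ≤ B := by
  have hk : (0 : ℝ) < k + 1 := by positivity
  -- Split `x^s` into `k + 1` equal factors: `k` of them absorb one logarithm each and the last is
  -- at most `1`. The extra factor keeps the denominator nonzero for `k = 0`.
  refine ⟨(1 / (s / (k + 1))) ^ k, fun x hx hx1 => ?_⟩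
  have h1 := (Real.abs_log_mul_self_rpow_lt x (s / (k + 1)) hx hx1 (by positivity)).le
  have h2 : x ^ s = x ^ (s / (k + 1)) * (x ^ (s / (k + 1))) ^ k := by
    rw [← pow_succ', ← Real.rpow_natCast, ← Real.rpow_mul hx.le]
    push_cast
    rw [div_mul_cancel₀ _ hk.ne']
  have h3 : |Real.log x * x ^ (s / (k + 1))| ^ k ≤ (1 / (s / (k + 1))) ^ k :=
    pow_le_pow_left₀ (abs_nonneg _) h1 k
  rw [abs_mul, abs_of_pos (Real.rpow_pos_of_pos hx _), mul_pow] at h3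
  have h4 : x ^ (s / (k + 1)) ≤ 1 := Real.rpow_le_one hx.le hx1 (by positivity)
  calc x ^ s * |Real.log x| ^ k
      = x ^ (s / (k + 1)) * (|Real.log x| ^ k * (x ^ (s / (k + 1))) ^ k) := by rw [h2]; ring
    _ ≤ 1 * (|Real.log x| ^ k * (x ^ (s / (k + 1))) ^ k) := by gcongr
    _ ≤ _ := by rw [one_mul]; exact h3

theorem IsLogSmooth.exists_bound {ε : ℝ} {w : ℂ} {f : ℝ × Sph d → ℂ} (hf : IsLogSmooth ε w f)
    (hε : ε ≤ 1) {t : ℝ} (ht : t < w.re) {S : Set (ℝ × Sph d)} (hS : IsCompact S)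
    (hSε : S ⊆ Ico 0 ε ×ˢ univ) :
    ∃ C : ℝ, ∀ p ∈ S, 0 < p.1 → ‖f p‖ ≤ C * p.1 ^ t := by
  obtain ⟨K, h, hh, hfh⟩ := hf
  have hterm : ∀ k, ∃ C : ℝ, ∀ p ∈ S, 0 < p.1 →
      ‖(p.1 : ℂ) ^ w * (Real.log p.1 : ℂ) ^ k * h k (√p.1, (p.2 : Euc d))‖ ≤ C * p.1 ^ t := by
    intro k
    have hcont : ContinuousOn (fun p : ℝ × Sph d => h k (√p.1, (p.2 : Euc d))) S := by
      refine (hh k).continuousOn.comp (f := fun p : ℝ × Sph d => (√p.1, (p.2 : Euc d)))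
        (by fun_prop) fun p hp => ⟨⟨Real.sqrt_nonneg _, ?_⟩, ne_zero_of_mem_unit_sphere p.2⟩
      exact Real.sqrt_lt_sqrt (hSε hp).1.1 (hSε hp).1.2
    obtain ⟨C, hC⟩ := hS.exists_bound_of_continuousOn hcont
    obtain ⟨B, hB⟩ := exists_rpow_mul_log_pow_le k (sub_pos.2 ht)
    refine ⟨B * C, fun p hp hp0 => ?_⟩
    have hp1 : p.1 ≤ 1 := (hSε hp).1.2.le.trans hε
    have hBp := hB p.1 hp0 hp1
    have hB0 : 0 ≤ B := le_trans (by positivity) hBp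
    rw [norm_mul, norm_mul, norm_pow, Complex.norm_real, Real.norm_eq_abs,
      Complex.norm_cpow_eq_rpow_re_of_pos hp0]
    calc p.1 ^ w.re * |Real.log p.1| ^ k * ‖h k (√p.1, (p.2 : Euc d))‖
        = p.1 ^ t * (p.1 ^ (w.re - t) * |Real.log p.1| ^ k) *
            ‖h k (√p.1, (p.2 : Euc d))‖ := by
          rw [← mul_assoc, ← Real.rpow_add hp0]; congr 3; ring
      _ ≤ p.1 ^ t * B * C := by
          gcongr
          exact hC p hp
      _ = B * C * p.1 ^ t := by ring
  choose C hC using hterm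
  refine ⟨∑ k ∈ Finset.range K, C k, fun p hp hp0 => ?_⟩
  rw [hfh p ⟨hp0, (hSε hp).1.2⟩, Finset.sum_mul]
  exact (norm_sum_le _ _).trans (Finset.sum_le_sum fun k _ => hC k p hp hp0)

theorem IsLogSmooth.isConormal {ε : ℝ} {w : ℂ} {f : ℝ × Sph d → ℂ} (hf : IsLogSmooth ε w f)
    (hε : ε ≤ 1) {t : ℝ} (ht : t < w.re) : IsConormal (𝓡 d) ε t f := by
  refine ⟨hf.contMDiffOn, fun L hL S hS hSε => ?_⟩
  suffices h : IsLogSmooth ε w (L.foldr (bDeriv (𝓡 d)) f) from h.exists_bound hε ht hS hSε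
  induction L with
  | nil => exact hf
  | cons X L ih =>
    exact (ih fun Y hY => hL Y (List.mem_cons_of_mem _ hY)).bDeriv_field (hL X List.mem_cons_self)

end LogSmooth

/-! ### Invariance of surface measure under linear isometries. -/

section SphereIsometry

variable {V W : Type*} [NormedAddCommGroup V] [NormedAddCommGroup W]
  [InnerProductSpace ℝ V] [InnerProductSpace ℝ W]

/-- The homeomorphism of unit spheres induced by a linear isometry. -/
def LinearIsometryEquiv.unitSphere (e : V ≃ₗᵢ[ℝ] W) :
    Metric.sphere (0 : V) 1 ≃ₜ Metric.sphere (0 : W) 1 where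
  toFun φ := ⟨e φ, by simp⟩
  invFun φ := ⟨e.symm φ, by simp⟩
  left_inv φ := by simp
  right_inv φ := by simp
  continuous_toFun := by fun_prop
  continuous_invFun := by fun_prop

theorem LinearIsometryEquiv.coe_unitSphere (e : V ≃ₗᵢ[ℝ] W) (φ : Metric.sphere (0 : V) 1) :
    (e.unitSphere φ : W) = e φ := rfl

variable [FiniteDimensional ℝ V] [FiniteDimensional ℝ W] [MeasurableSpace V] [MeasurableSpace W]
  [BorelSpace V] [BorelSpace W]

/-- The surface measure of a set is the dimension times the volume of the cone over it in the unit
ball, and an isometry carries cones to cones of equal volume. -/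
theorem LinearIsometryEquiv.measurePreserving_unitSphere (e : V ≃ₗᵢ[ℝ] W) :
    MeasurePreserving e.unitSphere (volume : Measure V).toSphere
      (volume : Measure W).toSphere := by
  refine ⟨e.unitSphere.measurable, ?_⟩
  ext s hs
  rw [Measure.map_apply e.unitSphere.measurable hs, Measure.toSphere_apply' _ hs,
    Measure.toSphere_apply' _ (e.unitSphere.measurable hs), e.toLinearEquiv.finrank_eq,
    ← e.measurePreserving.measure_preimage_emb e.toHomeomorph.measurableEmbedding]
  congr 2
  ext y
  simp only [Set.mem_smul, Set.mem_image, Set.mem_preimage]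
  constructor
  · rintro ⟨r, hr, _, ⟨φ, hφ, rfl⟩, rfl⟩
    exact ⟨r, hr, _, ⟨e.unitSphere φ, hφ, rfl⟩, by simp [e.coe_unitSphere]⟩
  · rintro ⟨r, hr, _, ⟨φ, hφ, rfl⟩, h⟩
    refine ⟨r, hr, _, ⟨e.unitSphere.symm φ, by simpa using hφ, rfl⟩, ?_⟩
    apply e.injective
    rw [map_smul, ← e.coe_unitSphere, Homeomorph.apply_symm_apply, h]

theorem LinearIsometryEquiv.integral_unitSphere (e : V ≃ₗᵢ[ℝ] W)
    (f : Metric.sphere (0 : W) 1 → ℂ) :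
    ∫ φ, f (e.unitSphere φ) ∂(volume : Measure V).toSphere =
      ∫ φ, f φ ∂(volume : Measure W).toSphere :=
  e.measurePreserving_unitSphere.integral_comp e.unitSphere.measurableEmbedding f

end SphereIsometry

/-! ### Joint smoothness of the fibre integral in `(q, θ)`. -/

section FiberIntegral

variable {d : ℕ}

theorem inner_perp (θ : Sph d) (y : perp θ) : inner ℝ (θ : Euc d) (y : Euc d) = 0 :=
  Submodule.mem_orthogonal_singleton_iff_inner_right.1 y.2

theorem finrank_perp (θ : Sph d) : Module.finrank ℝ (perp θ) = d :=
  haveI := Fact.mk (@finrank_euclideanSpace_fin ℝ _ (d + 1))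
  Submodule.finrank_orthogonal_span_singleton (ne_zero_of_mem_unit_sphere θ)

/-- The restriction to `θ₀^⊥` of the reflection that exchanges `θ₀` and `-θ`. -/
noncomputable def perpTransport (θ₀ : Sph d) (x : Euc d) (y : Euc d) : Euc d :=
  y - (inner ℝ x y / (1 + inner ℝ (θ₀ : Euc d) x)) • ((θ₀ : Euc d) + x)

theorem inner_perpTransport (θ₀ θ : Sph d) (h : 1 + inner ℝ (θ₀ : Euc d) (θ : Euc d) ≠ 0)
    (y : Euc d) : inner ℝ (θ : Euc d) (perpTransport θ₀ θ y) = 0 := by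
  have h1 : inner ℝ (θ : Euc d) (θ : Euc d) = 1 := by simp
  rw [perpTransport, inner_sub_right, inner_smul_right, inner_add_right, h1,
    real_inner_comm (θ₀ : Euc d) (θ : Euc d)]
  field_simp
  ring

theorem norm_perpTransport (θ₀ θ : Sph d) (h : 1 + inner ℝ (θ₀ : Euc d) (θ : Euc d) ≠ 0)
    (y : perp θ₀) : ‖perpTransport θ₀ θ y‖ = ‖y‖ := by
  have h1 : inner ℝ (θ : Euc d) (θ : Euc d) = 1 := by simp
  have h0 : inner ℝ (θ₀ : Euc d) (θ₀ : Euc d) = 1 := by simp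
  have hy := inner_perp θ₀ y
  rw [Submodule.coe_norm, ← sq_eq_sq₀ (norm_nonneg _) (norm_nonneg _),
    ← real_inner_self_eq_norm_sq, ← real_inner_self_eq_norm_sq, perpTransport]
  simp only [inner_sub_left, inner_sub_right, inner_smul_left, inner_smul_right, inner_add_left,
    inner_add_right, h1, h0, hy, real_inner_comm (θ₀ : Euc d) (y : Euc d),
    real_inner_comm (θ : Euc d) (y : Euc d), real_inner_comm (θ₀ : Euc d) (θ : Euc d)]
  simp only [conj_trivial]
  field_simp
  ring

/-- The isometry `θ₀^⊥ → θ^⊥` given by `perpTransport`. -/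
noncomputable def perpIsometry (θ₀ θ : Sph d)
    (h : 1 + inner ℝ (θ₀ : Euc d) (θ : Euc d) ≠ 0) : perp θ₀ ≃ₗᵢ[ℝ] perp θ :=
  LinearIsometry.toLinearIsometryEquiv
    { toFun := fun y => ⟨perpTransport θ₀ θ y,
        Submodule.mem_orthogonal_singleton_iff_inner_right.2 (inner_perpTransport θ₀ θ h y)⟩
      map_add' := fun y z => by
        apply Subtype.ext
        simp only [perpTransport, Submodule.coe_add, inner_add_right]
        module
      map_smul' := fun c y => by
        apply Subtype.ext
        simp only [perpTransport, Submodule.coe_smul, inner_smul_right, RingHom.id_apply]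
        module
      norm_map' := fun y => norm_perpTransport θ₀ θ h y }
    ((finrank_perp θ₀).trans (finrank_perp θ).symm)

/-- The domain of integration no longer depends on `θ`; all dependence has moved into the integrand.
-/
theorem fiberIntegral_eq_transport (a : Sph d → ℂ) (θ₀ θ : Sph d)
    (h : 1 + inner ℝ (θ₀ : Euc d) (θ : Euc d) ≠ 0) (q : ℝ) :
    fiberIntegral a θ q = ∫ φ : Metric.sphere (0 : perp θ₀) 1,
      radialExt a ((θ : Euc d) + q • perpTransport θ₀ θ ((φ : perp θ₀) : Euc d))
        ∂((volume : Measure (perp θ₀)).toSphere) :=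
  ((perpIsometry θ₀ θ h).integral_unitSphere
    fun φ => radialExt a ((θ : Euc d) + q • ((φ : perp θ) : Euc d))).symm

/-- The antipodal map `φ ↦ -φ` preserves the surface measure. Evenness is what removes half-integer
powers of `σ` relative to the leading one. -/
theorem fiberIntegral_neg (a : Sph d → ℂ) (θ : Sph d) (q : ℝ) :
    fiberIntegral a θ (-q) = fiberIntegral a θ q := by
  rw [fiberIntegral, ← (LinearIsometryEquiv.neg ℝ (E := perp θ)).integral_unitSphere]
  simp [LinearIsometryEquiv.coe_unitSphere, fiberIntegral]

theorem add_smul_ne_zero_of_inner_eq_zero {θ : Sph d} {v : Euc d}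
    (hv : inner ℝ (θ : Euc d) v = 0) (q : ℝ) : (θ : Euc d) + q • v ≠ 0 := by
  intro h
  have h1 : inner ℝ (θ : Euc d) ((θ : Euc d) + q • v) = 1 := by
    rw [inner_add_right, inner_smul_right, hv]; simp
  rw [h, inner_zero_right] at h1
  exact zero_ne_one h1

/-- The fibre integral, extended radially in `θ`. -/
noncomputable def fiberExt (a : Sph d → ℂ) (p : ℝ × Euc d) : ℂ := fiberIntegral a (sphProj p.2) p.1

/-- The directions near `θ₀` on which `perpTransport θ₀` is defined. -/
def transportDomain (θ₀ : Sph d) : Set (Euc d) :=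
  {0}ᶜ ∩ (fun x : Euc d => 1 + inner ℝ (θ₀ : Euc d) (sphProj x : Euc d)) ⁻¹' {0}ᶜ

theorem isOpen_transportDomain (θ₀ : Sph d) : IsOpen (transportDomain θ₀) := by
  have h : ContinuousOn (fun x : Euc d => 1 + inner ℝ (θ₀ : Euc d) (sphProj x : Euc d)) {0}ᶜ := by
    have h1 : ContinuousOn (fun x : Euc d => (sphProj x : Euc d)) {0}ᶜ :=
      contDiffOn_coe_sphProj.continuousOn
    fun_prop
  exact h.isOpen_inter_preimage isOpen_compl_singleton isOpen_compl_singleton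

theorem mem_transportDomain_self {x : Euc d} (hx : x ≠ 0) : x ∈ transportDomain (sphProj x) := by
  refine ⟨hx, ?_⟩
  simp only [mem_preimage, mem_compl_iff, mem_singleton_iff]
  rw [real_inner_self_eq_norm_sq]
  simp

/-- The integrand of the fibre integral, transported to the unit sphere of `θ₀^⊥`. -/
noncomputable def transportIntegrand (a : Sph d → ℂ) (θ₀ : Sph d) (z : (ℝ × Euc d) × perp θ₀) :
    ℂ :=
  radialExt a ((sphProj z.1.2 : Euc d) + z.1.1 • perpTransport θ₀ (sphProj z.1.2) (z.2 : Euc d))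

theorem contDiffOn_transport (θ₀ : Sph d) :
    ContDiffOn ℝ ∞ (fun z : (ℝ × Euc d) × perp θ₀ => (sphProj z.1.2 : Euc d) +
      z.1.1 • perpTransport θ₀ (sphProj z.1.2) (z.2 : Euc d))
      (((univ : Set ℝ) ×ˢ transportDomain θ₀) ×ˢ univ) := by
  have hx : ContDiffOn ℝ ∞ (fun z : (ℝ × Euc d) × perp θ₀ => (sphProj z.1.2 : Euc d))
      (((univ : Set ℝ) ×ˢ transportDomain θ₀) ×ˢ univ) :=
    contDiffOn_coe_sphProj.comp (f := fun z : (ℝ × Euc d) × perp θ₀ => z.1.2)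
      (contDiff_snd.comp contDiff_fst).contDiffOn fun z hz => hz.1.2.1
  have hq : ContDiffOn ℝ ∞ (fun z : (ℝ × Euc d) × perp θ₀ => z.1.1)
      (((univ : Set ℝ) ×ˢ transportDomain θ₀) ×ˢ univ) :=
    (contDiff_fst.comp contDiff_fst).contDiffOn
  have hy : ContDiffOn ℝ ∞ (fun z : (ℝ × Euc d) × perp θ₀ => (z.2 : Euc d))
      (((univ : Set ℝ) ×ˢ transportDomain θ₀) ×ˢ univ) :=
    ((perp θ₀).subtypeL.contDiff.comp contDiff_snd).contDiffOn
  have hc : ContDiffOn ℝ ∞ (fun _ : (ℝ × Euc d) × perp θ₀ => (θ₀ : Euc d))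
      (((univ : Set ℝ) ×ˢ transportDomain θ₀) ×ˢ univ) := contDiffOn_const
  have hdiv : ContDiffOn ℝ ∞ (fun z : (ℝ × Euc d) × perp θ₀ =>
      inner ℝ (sphProj z.1.2 : Euc d) (z.2 : Euc d) /
        (1 + inner ℝ (θ₀ : Euc d) (sphProj z.1.2 : Euc d)))
      (((univ : Set ℝ) ×ˢ transportDomain θ₀) ×ˢ univ) :=
    (hx.inner ℝ hy).div (contDiffOn_const.add (hc.inner ℝ hx)) fun z hz => hz.1.2.2
  exact hx.add (hq.smul (hy.sub (hdiv.smul (hc.add hx))))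

theorem contDiffOn_transportIntegrand {a : Sph d → ℂ} (ha : ContMDiff (𝓡 d) 𝓘(ℝ, ℂ) ∞ a)
    (θ₀ : Sph d) : ContDiffOn ℝ ∞ (transportIntegrand a θ₀)
      (((univ : Set ℝ) ×ˢ transportDomain θ₀) ×ˢ univ) :=
  (contDiffOn_radialExt ha).comp (contDiffOn_transport θ₀) fun _ hz =>
    add_smul_ne_zero_of_inner_eq_zero (inner_perpTransport θ₀ _ hz.1.2.2 _) _

theorem fiberExt_eq_integral_transportIntegrand (a : Sph d → ℂ) (θ₀ : Sph d) {p : ℝ × Euc d}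
    (hp : p.2 ∈ transportDomain θ₀) :
    fiberExt a p = ∫ φ : Metric.sphere (0 : perp θ₀) 1,
      (1 : ℂ) • transportIntegrand a θ₀ (p, (φ : perp θ₀))
        ∂(volume : Measure (perp θ₀)).toSphere := by
  simp only [one_smul]
  exact fiberIntegral_eq_transport a θ₀ (sphProj p.2) hp.2 p.1

theorem contDiffOn_fiberExt {a : Sph d → ℂ} (ha : ContMDiff (𝓡 d) 𝓘(ℝ, ℂ) ∞ a) :
    ContDiffOn ℝ ∞ (fiberExt a) (univ ×ˢ {0}ᶜ) := by
  intro p₀ hp₀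
  -- No single base direction serves the whole sphere, so each point uses its own.
  have hopen : IsOpen ((univ : Set ℝ) ×ˢ transportDomain (sphProj p₀.2)) :=
    isOpen_univ.prod (isOpen_transportDomain _)
  have hmem : p₀ ∈ (univ : Set ℝ) ×ˢ transportDomain (sphProj p₀.2) :=
    ⟨mem_univ _, mem_transportDomain_self hp₀.2⟩
  have hint := contDiffOn_integral_weight_smul
    (μ := (volume : Measure (perp (sphProj p₀.2))).toSphere) (w := fun _ => 1)
    (π := fun φ : Metric.sphere (0 : perp (sphProj p₀.2)) 1 => (φ : perp (sphProj p₀.2)))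
    (integrable_const _)
    continuous_subtype_val.aestronglyMeasurable (isCompact_sphere (0 : perp (sphProj p₀.2)) 1)
    (Eventually.of_forall fun φ => φ.2) hopen (contDiffOn_transportIntegrand ha _)
  refine ((hint.contDiffAt (hopen.mem_nhds hmem)).congr_of_eventuallyEq ?_).contDiffWithinAt
  filter_upwards [hopen.mem_nhds hmem] with p hp
  exact fiberExt_eq_integral_transportIntegrand a _ hp.2

end FiberIntegral

/-! ### Taylor's formula in one variable with a smooth remainder. -/

section PartialDerivative

variable {E : Type} [NormedAddCommGroup E] [NormedSpace ℝ E]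

/-- The partial derivative in the first, real variable. -/
noncomputable def fstDeriv (g : ℝ × E → ℂ) : ℝ × E → ℂ := fun p => fderiv ℝ g p (1, 0)

variable {U : Set E} {g : ℝ × E → ℂ}

theorem ContDiffOn.fstDeriv (hU : IsOpen U) (hg : ContDiffOn ℝ ∞ g (univ ×ˢ U)) :
    ContDiffOn ℝ ∞ (fstDeriv g) (univ ×ˢ U) :=
  (hg.fderiv_of_isOpen (isOpen_univ.prod hU) (by simp)).clm_apply contDiffOn_const

theorem ContDiffOn.iterate_fstDeriv (hU : IsOpen U) (hg : ContDiffOn ℝ ∞ g (univ ×ˢ U)) (j : ℕ) :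
    ContDiffOn ℝ ∞ (_root_.fstDeriv^[j] g) (univ ×ˢ U) := by
  induction j with
  | zero => exact hg
  | succ j ih => rw [Function.iterate_succ_apply']; exact ih.fstDeriv hU

theorem contDiff_slice (hg : ContDiffOn ℝ ∞ g (univ ×ˢ U)) {x : E} (hx : x ∈ U) :
    ContDiff ℝ ∞ (fun q => g (q, x)) := by
  rw [← contDiffOn_univ]
  exact hg.comp (f := fun q : ℝ => (q, x)) (by fun_prop) fun q _ => ⟨mem_univ _, hx⟩

theorem hasDerivAt_slice (hU : IsOpen U) (hg : ContDiffOn ℝ ∞ g (univ ×ˢ U)) {x : E} (hx : x ∈ U)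
    (q : ℝ) : HasDerivAt (fun q => g (q, x)) (fstDeriv g (q, x)) q := by
  have h1 : HasFDerivAt g (fderiv ℝ g (q, x)) (q, x) :=
    ((hg.contDiffAt ((isOpen_univ.prod hU).mem_nhds ⟨mem_univ _, hx⟩)).differentiableAt
      (by simp)).hasFDerivAt
  exact h1.comp_hasDerivAt q ((hasDerivAt_id q).prodMk (hasDerivAt_const q x))

theorem iteratedDeriv_slice (hU : IsOpen U) (hg : ContDiffOn ℝ ∞ g (univ ×ˢ U)) {x : E}
    (hx : x ∈ U) (j : ℕ) :
    iteratedDeriv j (fun q => g (q, x)) = fun q => (fstDeriv^[j] g) (q, x) := by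
  induction j with
  | zero => simp
  | succ j ih =>
    rw [iteratedDeriv_succ, ih, Function.iterate_succ_apply']
    funext q
    exact (hasDerivAt_slice hU (hg.iterate_fstDeriv hU j) hx q).deriv

/-- Taylor's formula for `t ↦ f (q t)` on `[0, 1]`: the power of `q` leaves the remainder, and the
interval of integration is independent of `q`, so the remaining factor is smooth through `q = 0`. -/
theorem taylor_unit_interval {f : ℝ → ℂ} (hf : ContDiff ℝ ∞ f) (n : ℕ) (q : ℝ) :
    f q = ∑ j ∈ Finset.range (n + 1), (q : ℂ) ^ j * (iteratedDeriv j f 0 / (j.factorial : ℂ)) +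
      (q : ℂ) ^ (n + 1) * ∫ τ in (0 : ℝ)..1,
        (((1 - τ) ^ n / n.factorial : ℝ) : ℂ) * iteratedDeriv (n + 1) f (τ * q) := by
  have hcomp : ∀ (j : ℕ) (t : ℝ), iteratedDeriv j (fun t => f (q * t)) t =
      (q : ℂ) ^ j * iteratedDeriv j f (q * t) := by
    intro j t
    have h := congrFun (iteratedDeriv_comp_const_smul (n := j)
      (hf.of_le (by exact_mod_cast le_top)) q) t
    simpa using h
  have hF : ContDiff ℝ ∞ (fun t => f (q * t)) := hf.comp (by fun_prop)
  have hw : ∀ (j : ℕ) (t : ℝ), t ∈ uIcc (0 : ℝ) 1 →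
      iteratedDerivWithin j (fun t => f (q * t)) (uIcc 0 1) t =
      (q : ℂ) ^ j * iteratedDeriv j f (q * t) := by
    intro j t ht
    rw [iteratedDerivWithin_eq_iteratedDeriv (uniqueDiffOn_uIcc zero_ne_one)
      ((hF.of_le (by exact_mod_cast le_top)).contDiffAt) ht, hcomp]
  have h := taylor_integral_remainder (x₀ := 0) (x := 1) (n := n)
    ((hF.of_le (by exact_mod_cast le_top)).contDiffOn (s := uIcc (0 : ℝ) 1))
  rw [sub_eq_iff_eq_add', taylor_within_apply] at h
  rw [mul_one] at h
  rw [h]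
  congr 1
  · refine Finset.sum_congr rfl fun j _ => ?_
    rw [hw j 0 left_mem_uIcc]
    simp
    ring
  · rw [← intervalIntegral.integral_const_mul]
    refine intervalIntegral.integral_congr fun τ hτ => ?_
    rw [hw _ τ hτ, mul_comm τ q, Complex.real_smul]
    ring

/-- Taylor's formula in the first variable, with a remainder that is smooth in all variables. -/
theorem exists_taylor_remainder [FiniteDimensional ℝ E] (hU : IsOpen U)
    (hg : ContDiffOn ℝ ∞ g (univ ×ˢ U)) (M : ℕ) :
    ∃ R : ℝ × E → ℂ, ContDiffOn ℝ ∞ R (univ ×ˢ U) ∧ ∀ q, ∀ x ∈ U,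
      g (q, x) = ∑ j ∈ Finset.range M,
        (q : ℂ) ^ j * (iteratedDeriv j (fun q => g (q, x)) 0 / (j.factorial : ℂ)) +
        (q : ℂ) ^ M * R (q, x) := by
  cases M with
  | zero => exact ⟨g, hg, fun q x _ => by simp⟩
  | succ n =>
    have hgn := hg.iterate_fstDeriv hU (n + 1)
    refine ⟨fun p => ∫ τ in Ioc (0 : ℝ) 1, (((1 - τ) ^ n / n.factorial : ℝ) : ℂ) •
      (fstDeriv^[n + 1] g) (τ * p.1, p.2), ?_, fun q x hx => ?_⟩
    · refine contDiffOn_integral_weight_smul (μ := volume.restrict (Ioc (0 : ℝ) 1))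
        (π := fun τ => τ) (E := ℝ × E) (P := ℝ) (F := ℂ) (U := univ ×ˢ U)
        (g := fun z => (fstDeriv^[n + 1] g) (z.2 * z.1.1, z.1.2)) ?_
        aestronglyMeasurable_id isCompact_Icc
        ((ae_restrict_mem measurableSet_Ioc).mono fun τ hτ => Ioc_subset_Icc_self hτ)
        (isOpen_univ.prod hU) ?_
      · exact (Continuous.integrableOn_Ioc (by fun_prop))
      · exact hgn.comp (f := fun z : (ℝ × E) × ℝ => (z.2 * z.1.1, z.1.2)) (by fun_prop)
          fun z hz => ⟨mem_univ _, hz.1.2⟩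
    · have h := taylor_unit_interval (contDiff_slice hg hx) n q
      rw [iteratedDeriv_slice hU hg hx (n + 1), intervalIntegral.integral_of_le zero_le_one] at h
      exact h

end PartialDerivative

/-! ### Smoothness of the functions `A_p` and the even Taylor expansion. -/

section FiberCoeff

variable {d : ℕ} {a : Sph d → ℂ}

theorem fiberExt_slice (a : Sph d → ℂ) (θ : Sph d) :
    (fun q => fiberExt a (q, (θ : Euc d))) = fiberIntegral a θ := by
  funext q
  simp [fiberExt, sphProj_coe]

theorem contDiff_fiberIntegral (ha : ContMDiff (𝓡 d) 𝓘(ℝ, ℂ) ∞ a) (θ : Sph d) :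
    ContDiff ℝ ∞ (fiberIntegral a θ) := by
  rw [← fiberExt_slice]
  exact contDiff_slice (contDiffOn_fiberExt ha) (ne_zero_of_mem_unit_sphere θ)

theorem contDiffOn_fiberCoeff_sphProj (ha : ContMDiff (𝓡 d) 𝓘(ℝ, ℂ) ∞ a) (p : ℕ) :
    ContDiffOn ℝ ∞ (fun x => fiberCoeff a p (sphProj x)) {0}ᶜ := by
  have h := (contDiffOn_fiberExt ha).iterate_fstDeriv isOpen_compl_singleton (2 * p)
  have h2 : ContDiffOn ℝ ∞ (fun x : Euc d => (1 / 2 : ℂ) *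
      ((fstDeriv^[2 * p] (fiberExt a)) (0, x) / ((2 * p).factorial : ℂ))) {0}ᶜ :=
    contDiffOn_const.mul ((h.comp (f := fun x : Euc d => ((0 : ℝ), x)) (by fun_prop)
      fun x hx => ⟨mem_univ _, hx⟩).div_const _)
  refine h2.congr fun x hx => ?_
  have h3 := congrFun (iteratedDeriv_slice isOpen_compl_singleton (contDiffOn_fiberExt ha) hx
    (2 * p)) 0
  rw [fiberCoeff, ← h3]
  rfl

theorem contMDiff_fiberCoeff (ha : ContMDiff (𝓡 d) 𝓘(ℝ, ℂ) ∞ a) (p : ℕ) :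
    ContMDiff (𝓡 d) 𝓘(ℝ, ℂ) ∞ (fiberCoeff a p) := by
  have h := contMDiff_of_contDiffOn_compl_zero (contDiffOn_fiberCoeff_sphProj ha p)
  simpa only [sphProj_coe] using h

theorem iteratedDeriv_fiberIntegral_odd (a : Sph d → ℂ) (θ : Sph d) (p : ℕ) :
    iteratedDeriv (2 * p + 1) (fiberIntegral a θ) 0 = 0 := by
  have h := iteratedDeriv_comp_neg (2 * p + 1) (fiberIntegral a θ) 0
  simp only [fiberIntegral_neg, neg_zero] at h
  rw [Odd.neg_one_pow ⟨p, rfl⟩, neg_one_smul] at h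
  exact self_eq_neg.1 h

theorem sum_range_two_mul (N : ℕ) (f : ℕ → ℂ) :
    ∑ j ∈ Finset.range (2 * N), f j =
      ∑ p ∈ Finset.range N, (f (2 * p) + f (2 * p + 1)) := by
  induction N with
  | zero => simp
  | succ N ih =>
    rw [Finset.sum_range_succ, ← ih, mul_add, mul_one, Finset.sum_range_succ,
      Finset.sum_range_succ, add_assoc]

/-- The even Taylor expansion of the fibre integral, with a smooth remainder. -/
theorem exists_fiberExt_taylor (ha : ContMDiff (𝓡 d) 𝓘(ℝ, ℂ) ∞ a) (N : ℕ) :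
    ∃ R : ℝ × Euc d → ℂ, ContDiffOn ℝ ∞ R (univ ×ˢ {0}ᶜ) ∧ ∀ (q : ℝ) (x : Euc d), x ≠ 0 →
      fiberExt a (q, x) =
        ∑ p ∈ Finset.range N, 2 * fiberCoeff a p (sphProj x) * (q : ℂ) ^ (2 * p) +
        (q : ℂ) ^ (2 * N) * R (q, x) := by
  obtain ⟨R, hR, h⟩ := exists_taylor_remainder isOpen_compl_singleton (contDiffOn_fiberExt ha)
    (2 * N)
  refine ⟨R, hR, fun q x hx => ?_⟩
  rw [h q x hx, sum_range_two_mul]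
  congr 1
  refine Finset.sum_congr rfl fun p _ => ?_
  have h1 : (fun q => fiberExt a (q, x)) = fiberIntegral a (sphProj x) := rfl
  -- Odd terms vanish; the factor `2` in the statement undoes the half in `fiberCoeff`.
  rw [h1, iteratedDeriv_fiberIntegral_odd, fiberCoeff]
  ring

end FiberCoeff

/-! ### Expansion of `(w / (1 - w))^p`. -/

section Binomial

theorem chooseSub_succ_succ (m p : ℕ) :
    chooseSub (m + 1) (p + 1) = chooseSub m p + chooseSub m (p + 1) := by
  cases m with
  | zero => cases p <;> simp [chooseSub]
  | succ m => cases p <;> simp [chooseSub, Nat.choose_succ_succ]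

theorem chooseSub_zero_succ (p : ℕ) : chooseSub 0 (p + 1) = 0 := rfl

/-- The expansion of `(w / (1 - w))^p` at `w = 0`, with a smooth remainder. -/
theorem exists_div_one_sub_pow_expansion (N : ℕ) : ∀ p : ℕ, ∃ R : ℝ → ℝ,
    ContDiffOn ℝ ∞ R (Iio 1) ∧ ∀ w < 1, (w / (1 - w)) ^ p =
      ∑ m ∈ Finset.range N, (chooseSub m p : ℝ) * w ^ m + w ^ N * R w := by
  induction N with
  | zero =>
    intro p
    refine ⟨fun w => (w / (1 - w)) ^ p, ?_, fun w _ => by simp⟩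
    refine ContDiffOn.pow (contDiffOn_id.div (contDiffOn_const.sub contDiffOn_id) ?_) p
    exact fun w hw => sub_ne_zero.2 (ne_of_gt hw)
  | succ N ih =>
    intro p
    cases p with
    | zero =>
      refine ⟨fun _ => 0, contDiffOn_const, fun w _ => ?_⟩
      rw [Finset.sum_range_succ']
      simp [chooseSub]
    | succ p =>
      obtain ⟨R₁, hR₁, h₁⟩ := ih p
      obtain ⟨R₂, hR₂, h₂⟩ := ih (p + 1)
      refine ⟨fun w => R₁ w + R₂ w, hR₁.add hR₂, fun w hw => ?_⟩
      have hw' : 1 - w ≠ 0 := sub_ne_zero.2 (ne_of_gt hw)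
      -- With `v = w / (1 - w)` one has `v = w (1 + v)`, hence this identity; on coefficients it is
      -- Pascal's rule `chooseSub_succ_succ`.
      have h3 : (w / (1 - w)) ^ (p + 1) =
          w * ((w / (1 - w)) ^ p + (w / (1 - w)) ^ (p + 1)) := by
        rw [pow_succ]
        field_simp
        ring
      rw [h3, h₁ w hw, h₂ w hw, Finset.sum_range_succ']
      simp only [chooseSub_succ_succ, Nat.cast_add, add_mul, Finset.sum_add_distrib, mul_add,
        Finset.mul_sum, pow_succ]
      simp only [chooseSub_zero_succ, Nat.cast_zero, zero_mul, add_zero]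
      have h4 : ∀ (q : ℕ), ∑ i ∈ Finset.range N, w * ((chooseSub i q : ℝ) * w ^ i) =
          ∑ i ∈ Finset.range N, (chooseSub i q : ℝ) * (w ^ i * w) := fun q =>
        Finset.sum_congr rfl fun i _ => by ring
      rw [h4, h4]
      ring

end Binomial

/-! ### Moments of the radial weight as derivatives of the Beta function. -/

section Moments

/-- The function `log(x)^j (1 - x)^(D/2 - 1)` on `(0, 1)`, extended by zero. -/
noncomputable def logBetaKernel (D j : ℕ) : ℝ → ℂ :=
  indicator (Ioo 0 1) fun x => (Real.log x : ℂ) ^ j * (1 - (x : ℂ)) ^ ((D : ℂ) / 2 - 1)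

theorem log_smul_logBetaKernel (D j : ℕ) (x : ℝ) :
    Real.log x • logBetaKernel D j x = logBetaKernel D (j + 1) x := by
  rw [logBetaKernel, logBetaKernel, indicator_apply, indicator_apply]
  split_ifs
  · rw [Complex.real_smul]; ring
  · simp

theorem locallyIntegrableOn_logBetaKernel {D : ℕ} (hD : 1 ≤ D) (j : ℕ) :
    LocallyIntegrableOn (logBetaKernel D j) (Ioi 0) := by
  induction j with
  | zero =>
    refine IntegrableOn.locallyIntegrableOn (Integrable.integrableOn ?_)
    rw [logBetaKernel, integrable_indicator_iff measurableSet_Ioo]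
    have hv : 0 < ((D : ℂ) / 2).re := by
      have : (0 : ℝ) < D := by exact_mod_cast hD
      simpa using this
    -- The choice `u = 1` removes the power of `x`, leaving only the possible singularity at `x =
    -- 1`.
    have h := Complex.betaIntegral_convergent (u := 1) (by simp) hv
    rw [intervalIntegrable_iff_integrableOn_Ioo_of_le zero_le_one] at h
    simpa using h
  | succ j ih =>
    have hlog : ContinuousOn Real.log (Ioi 0) :=
      Real.continuousOn_log.mono fun x hx => ne_of_gt hx
    have h := ih.continuousOn_smul isOpen_Ioi.isLocallyClosed hlog
    simpa only [log_smul_logBetaKernel] using h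

/-- Each logarithm costs an arbitrarily small power of `x`; in the induction half of `b` is spent on
the new one. -/
theorem isBigO_logBetaKernel_zero (D j : ℕ) : ∀ b : ℝ, 0 < b →
    logBetaKernel D j =O[𝓝[>] 0] fun x : ℝ => x ^ (-b) := by
  have h0 : ∀ b : ℝ, 0 < b → logBetaKernel D 0 =O[𝓝[>] 0] fun x : ℝ => x ^ (-b) := by
    intro b hb
    have h1 : logBetaKernel D 0 =ᶠ[𝓝[>] 0] fun x : ℝ => (1 - (x : ℂ)) ^ ((D : ℂ) / 2 - 1) := by
      filter_upwards [Ioo_mem_nhdsGT (zero_lt_one' ℝ)] with x hx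
      rw [logBetaKernel, indicator_of_mem hx, pow_zero, one_mul]
    have hcont : ContinuousAt (fun x : ℝ => (1 - (x : ℂ)) ^ ((D : ℂ) / 2 - 1)) 0 := by
      apply ContinuousAt.cpow (by fun_prop) (by fun_prop)
      simp
    have h2 : (fun x : ℝ => (1 - (x : ℂ)) ^ ((D : ℂ) / 2 - 1)) =O[𝓝[>] 0] fun _ => (1 : ℝ) :=
      (hcont.tendsto.mono_left nhdsWithin_le_nhds).isBigO_one ℝ
    refine (h1.trans_isBigO h2).trans ?_
    refine Asymptotics.IsBigO.of_bound 1 ?_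
    filter_upwards [Ioo_mem_nhdsGT (zero_lt_one' ℝ)] with x hx
    rw [norm_one, one_mul]
    exact (Real.one_le_rpow_of_pos_of_le_one_of_nonpos hx.1 hx.2.le (by linarith)).trans
      (le_abs_self _)
  induction j with
  | zero => exact h0
  | succ j ih =>
    intro b hb
    have h := isBigO_rpow_zero_log_smul (half_lt_self hb) (ih (b / 2) (half_pos hb))
    simpa only [log_smul_logBetaKernel] using h

theorem isBigO_logBetaKernel_top (D j : ℕ) (a : ℝ) :
    logBetaKernel D j =O[atTop] fun x : ℝ => x ^ (-a) := by
  have h : logBetaKernel D j =ᶠ[atTop] fun _ => 0 := by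
    filter_upwards [eventually_ge_atTop 1] with x hx
    exact indicator_of_notMem (fun h => absurd h.2 (not_lt.2 hx)) _
  exact h.trans_isBigO (Asymptotics.isBigO_zero _ _)

theorem hasDerivAt_mellin_logBetaKernel {D : ℕ} (hD : 1 ≤ D) (j : ℕ) {s : ℂ} (hs : 0 < s.re) :
    MellinConvergent (logBetaKernel D (j + 1)) s ∧
      HasDerivAt (mellin (logBetaKernel D j)) (mellin (logBetaKernel D (j + 1)) s) s := by
  have h := mellin_hasDerivAt_of_isBigO_rpow (locallyIntegrableOn_logBetaKernel hD j)
    (isBigO_logBetaKernel_top D j (s.re + 1)) (by linarith)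
    (isBigO_logBetaKernel_zero D j (s.re / 2) (by linarith)) (by linarith)
  simpa only [log_smul_logBetaKernel] using h

theorem mellinConvergent_logBetaKernel {D : ℕ} (hD : 1 ≤ D) (j : ℕ) {s : ℂ} (hs : 0 < s.re) :
    MellinConvergent (logBetaKernel D j) s :=
  mellinConvergent_of_isBigO_rpow (locallyIntegrableOn_logBetaKernel hD j)
    (isBigO_logBetaKernel_top D j (s.re + 1)) (by linarith)
    (isBigO_logBetaKernel_zero D j (s.re / 2) (by linarith)) (by linarith)

theorem cpow_smul_logBetaKernel (D j : ℕ) (η : ℂ) :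
    (fun x : ℝ => (x : ℂ) ^ (η + 1 - 1) • logBetaKernel D j x) = indicator (Ioo 0 1) fun x : ℝ =>
      (x : ℂ) ^ η * ((Real.log x : ℂ) ^ j * (1 - (x : ℂ)) ^ ((D : ℂ) / 2 - 1)) := by
  funext x
  rw [logBetaKernel, indicator_apply, indicator_apply, add_sub_cancel_right]
  split_ifs <;> simp

theorem mellin_logBetaKernel (D j : ℕ) (η : ℂ) :
    mellin (logBetaKernel D j) (η + 1) = ∫ x in Ioo (0 : ℝ) 1,
      (x : ℂ) ^ η * ((Real.log x : ℂ) ^ j * (1 - (x : ℂ)) ^ ((D : ℂ) / 2 - 1)) := by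
  rw [mellin, cpow_smul_logBetaKernel, setIntegral_indicator measurableSet_Ioo,
    inter_eq_right.2 Ioo_subset_Ioi_self]

/-- `B(η + 1, D/2)` is a Mellin transform at `η + 1`, and differentiating a Mellin transform
multiplies the kernel by `log x`. The point `γ` stays general in the induction because the next
derivative needs the formula on a neighbourhood. -/
theorem iteratedDeriv_betaIntegral {D : ℕ} (hD : 1 ≤ D) (j : ℕ) : ∀ {γ : ℂ}, -1 < γ.re →
    iteratedDeriv j (fun η : ℂ => Complex.betaIntegral (η + 1) ((D : ℂ) / 2)) γ =
      mellin (logBetaKernel D j) (γ + 1) := by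
  induction j with
  | zero =>
    intro γ _
    rw [mellin_logBetaKernel, iteratedDeriv_zero, Complex.betaIntegral,
      intervalIntegral.integral_of_le zero_le_one, integral_Ioc_eq_integral_Ioo]
    simp
  | succ j ih =>
    intro γ hγ
    have h1 : iteratedDeriv j (fun η : ℂ => Complex.betaIntegral (η + 1) ((D : ℂ) / 2)) =ᶠ[𝓝 γ]
        fun η => mellin (logBetaKernel D j) (η + 1) := by
      filter_upwards [(isOpen_lt continuous_const Complex.continuous_re).mem_nhds hγ] with η hη
      exact ih hη
    rw [iteratedDeriv_succ, h1.deriv_eq]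
    have h2 := (hasDerivAt_mellin_logBetaKernel hD j (s := γ + 1) (by simp; linarith)).2
    exact (h2.comp_add_const γ 1).deriv

/-- The radial weight `t^(D-1) (1 - t²)^γ log(1 - t²)^j` on the unit interval. -/
noncomputable def radialWeight (D : ℕ) (γ : ℂ) (j : ℕ) (t : ℝ) : ℂ :=
  (t : ℂ) ^ (D - 1) * ((1 - t ^ 2 : ℝ) : ℂ) ^ γ * (Real.log (1 - t ^ 2) : ℂ) ^ j

/-- Even moments are absorbed by raising the dimension parameter, so the case without moments
suffices; accordingly `D/2` becomes `d/2 + p`. -/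
theorem pow_mul_radialWeight {D : ℕ} (hD : 1 ≤ D) (γ : ℂ) (j p : ℕ) (t : ℝ) :
    (t : ℂ) ^ (2 * p) * radialWeight D γ j t = radialWeight (D + 2 * p) γ j t := by
  rw [radialWeight, radialWeight, show D + 2 * p - 1 = 2 * p + (D - 1) by omega, pow_add]
  ring

theorem image_one_sub_sq : (fun t : ℝ => 1 - t ^ 2) '' Ioo 0 1 = Ioo 0 1 := by
  ext x
  constructor
  · rintro ⟨t, ht, rfl⟩
    have h1 := ht.1
    have h2 := ht.2
    constructor <;> simp only <;> nlinarith
  · intro hx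
    refine ⟨√(1 - x), ⟨Real.sqrt_pos.2 (by linarith [hx.2]), ?_⟩, ?_⟩
    · rw [Real.sqrt_lt' one_pos]; linarith [hx.1]
    · simp only
      rw [Real.sq_sqrt (by linarith [hx.2])]; ring

theorem hasDerivWithinAt_one_sub_sq (t : ℝ) (s : Set ℝ) :
    HasDerivWithinAt (fun t : ℝ => 1 - t ^ 2) (-(2 * t)) s t := by
  have h := (hasDerivAt_pow 2 t).const_sub 1
  simpa using h.hasDerivWithinAt

theorem injOn_one_sub_sq : InjOn (fun t : ℝ => 1 - t ^ 2) (Ioo 0 1) := by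
  intro x hx y hy h
  simp only [sub_right_inj] at h
  exact (sq_eq_sq₀ hx.1.le hy.1.le).1 h

/-- Under `x = 1 - t²` the Jacobian is `2t` and `(1 - x)^(D/2 - 1) = t^(D - 2)`, whose product is `2
t^(D - 1)`. -/
theorem abs_deriv_smul_betaKernel {D : ℕ} (hD : 1 ≤ D) (γ : ℂ) (j : ℕ) {t : ℝ}
    (ht : t ∈ Ioo (0 : ℝ) 1) :
    |-(2 * t)| • (((1 - t ^ 2 : ℝ) : ℂ) ^ γ * ((Real.log (1 - t ^ 2) : ℂ) ^ j *
      (1 - ((1 - t ^ 2 : ℝ) : ℂ)) ^ ((D : ℂ) / 2 - 1))) = 2 * radialWeight D γ j t := by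
  have h0 : (0 : ℝ) < t := ht.1
  have h1 : (1 - ((1 - t ^ 2 : ℝ) : ℂ)) ^ ((D : ℂ) / 2 - 1) =
      (((t ^ 2) ^ ((D : ℝ) / 2 - 1) : ℝ) : ℂ) := by
    rw [Complex.ofReal_cpow (sq_nonneg t)]
    push_cast
    ring_nf
  have h2 : t * (t ^ 2) ^ ((D : ℝ) / 2 - 1) = t ^ (D - 1) := by
    rw [← Real.rpow_natCast t 2, ← Real.rpow_mul h0.le, ← Real.rpow_natCast t (D - 1),
      Nat.cast_sub hD]
    nth_rewrite 1 [← Real.rpow_one t]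
    rw [← Real.rpow_add h0]
    congr 1
    push_cast
    ring
  have h3 : (t : ℂ) ^ (D - 1) = (t : ℂ) * (((t ^ 2) ^ ((D : ℝ) / 2 - 1) : ℝ) : ℂ) := by
    rw [← Complex.ofReal_mul, h2, Complex.ofReal_pow]
  rw [h1, abs_neg, abs_of_pos (by linarith), Complex.real_smul, radialWeight, h3,
    Complex.ofReal_mul, Complex.ofReal_ofNat]
  ring

theorem integrableOn_radialWeight {D : ℕ} (hD : 1 ≤ D) {γ : ℂ} (hγ : -1 < γ.re) (j : ℕ) :
    IntegrableOn (radialWeight D γ j) (Ioo 0 1) := by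
  have h1 := mellinConvergent_logBetaKernel hD j (s := γ + 1) (by simp; linarith)
  rw [MellinConvergent, cpow_smul_logBetaKernel] at h1
  have h2 : IntegrableOn (fun x : ℝ => (x : ℂ) ^ γ * ((Real.log x : ℂ) ^ j *
      (1 - (x : ℂ)) ^ ((D : ℂ) / 2 - 1))) (Ioo 0 1) := by
    rw [← integrable_indicator_iff measurableSet_Ioo]
    refine (integrableOn_iff_integrable_of_support_subset fun x hx => ?_).1 h1
    exact Ioo_subset_Ioi_self (mem_of_indicator_ne_zero hx)
  rw [← image_one_sub_sq, integrableOn_image_iff_integrableOn_abs_deriv_smul measurableSet_Ioo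
    (fun t _ => hasDerivWithinAt_one_sub_sq t _) injOn_one_sub_sq] at h2
  have h3 := h2.congr_fun (fun t ht => abs_deriv_smul_betaKernel hD γ j ht) measurableSet_Ioo
  have h4 := h3.const_mul (2⁻¹ : ℂ)
  simp only [inv_mul_cancel_left₀ (two_ne_zero' ℂ)] at h4
  exact h4

theorem integral_radialWeight {D : ℕ} (hD : 1 ≤ D) {γ : ℂ} (hγ : -1 < γ.re) (j : ℕ) :
    ∫ t in Ioo (0 : ℝ) 1, radialWeight D γ j t =
      (1 / 2) * iteratedDeriv j (fun η : ℂ => Complex.betaIntegral (η + 1) ((D : ℂ) / 2)) γ := by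
  rw [iteratedDeriv_betaIntegral hD j hγ, mellin_logBetaKernel]
  nth_rewrite 2 [← image_one_sub_sq]
  rw [integral_image_eq_integral_abs_deriv_smul measurableSet_Ioo
    (fun t _ => hasDerivWithinAt_one_sub_sq t _) injOn_one_sub_sq,
    setIntegral_congr_fun measurableSet_Ioo (fun t ht => abs_deriv_smul_betaKernel hD γ j ht),
    integral_const_mul]
  ring

end Moments

/-! ### Integration in polar coordinates. -/

section Polar

variable {V : Type*} [NormedAddCommGroup V] [NormedSpace ℝ V] [MeasurableSpace V] [BorelSpace V]
  [FiniteDimensional ℝ V] [Nontrivial V]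

theorem integral_eq_integral_Ioi_sphere (μ : Measure V) [μ.IsAddHaarMeasure] {f : V → ℂ}
    (hf : Integrable f μ) :
    ∫ x, f x ∂μ = ∫ r in Ioi (0 : ℝ), (r : ℂ) ^ (Module.finrank ℝ V - 1) *
      ∫ φ : Metric.sphere (0 : V) 1, f (r • (φ : V)) ∂μ.toSphere := by
  let G : Metric.sphere (0 : V) 1 × Ioi (0 : ℝ) → ℂ := fun z => f (z.2.1 • (z.1 : V))
  have hG : ∀ x : ({(0 : V)}ᶜ : Set V), G (homeomorphUnitSphereProd V x) = f x := by
    intro x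
    have hx : ‖(x : V)‖ ≠ 0 := norm_ne_zero_iff.2 x.2
    simp only [G, homeomorphUnitSphereProd_apply_snd_coe, homeomorphUnitSphereProd_apply_fst_coe]
    rw [smul_smul, mul_inv_cancel₀ hx, one_smul]
  have hmp := μ.measurePreserving_homeomorphUnitSphereProd
  have hemb := (homeomorphUnitSphereProd V).measurableEmbedding
  have hGint : Integrable G (μ.toSphere.prod (.volumeIoiPow (Module.finrank ℝ V - 1))) := by
    rw [← hmp.integrable_comp_emb hemb]
    have h1 : Integrable (f ∘ ((↑) : ({(0 : V)}ᶜ : Set V) → V)) (μ.comap (↑)) :=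
      (integrableOn_iff_comap_subtypeVal (measurableSet_singleton _).compl).1 hf.integrableOn
    exact h1.congr (Eventually.of_forall fun x => (hG x).symm)
  calc ∫ x, f x ∂μ = ∫ x : ({(0 : V)}ᶜ : Set V), f x ∂(μ.comap (↑)) := by
        rw [integral_subtype_comap (measurableSet_singleton _).compl f,
          restrict_compl_singleton]
    _ = ∫ x : ({(0 : V)}ᶜ : Set V), G (homeomorphUnitSphereProd V x) ∂(μ.comap (↑)) := by
        simp only [hG]
    _ = ∫ z, G z ∂(μ.toSphere.prod (.volumeIoiPow (Module.finrank ℝ V - 1))) :=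
        hmp.integral_comp hemb G
    _ = ∫ r : Ioi (0 : ℝ), ∫ φ, G (φ, r) ∂μ.toSphere
          ∂(.volumeIoiPow (Module.finrank ℝ V - 1)) := integral_prod_symm _ hGint
    _ = _ := by
        simp only [Measure.volumeIoiPow, ENNReal.ofReal]
        rw [integral_withDensity_eq_integral_smul
            ((measurable_subtype_coe.pow_const _).real_toNNReal),
          integral_subtype_comap measurableSet_Ioi fun r : ℝ =>
            Real.toNNReal (r ^ (Module.finrank ℝ V - 1)) •
              ∫ φ : Metric.sphere (0 : V) 1, f (r • (φ : V)) ∂μ.toSphere,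
          setIntegral_congr_fun measurableSet_Ioi fun r hr => ?_]
        rw [NNReal.smul_def, Real.coe_toNNReal _ (pow_nonneg hr.out.le _), Complex.real_smul]
        push_cast
        rfl

end Polar

/-! ### The radial profile: scaling and integrability. -/

section Profile

/-- The profile `ρ^γ log(ρ)^ℓ χ(ρ)`, extended by zero to `ρ ≤ 0`. -/
noncomputable def phgProfile (γ : ℂ) (ℓ : ℕ) (χ : ℝ → ℝ) (ρ : ℝ) : ℂ :=
  if 0 < ρ then (ρ : ℂ) ^ γ * (Real.log ρ : ℂ) ^ ℓ * (χ ρ : ℂ) else 0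

variable {d : ℕ}

theorem phgComponent_eq (a : Sph d → ℂ) (γ : ℂ) (ℓ : ℕ) (χ : ℝ → ℝ) (x : Euc d) :
    phgComponent a γ ℓ χ x = radialExt a x * phgProfile γ ℓ χ (1 - ‖x‖ ^ 2) := by
  have h : ‖x‖ < 1 ↔ 0 < 1 - ‖x‖ ^ 2 := by
    rw [sub_pos, sq_lt_one_iff₀ (norm_nonneg x)]
  rw [phgComponent, phgProfile]
  simp only [h]
  split_ifs
  · ring
  · simp

theorem norm_sq_smul_add_perp (s : ℝ) (θ : Sph d) (y : perp θ) :
    ‖s • (θ : Euc d) + (y : Euc d)‖ ^ 2 = s ^ 2 + ‖y‖ ^ 2 := by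
  rw [norm_add_sq_real, inner_smul_left, inner_perp, norm_smul]
  simp

theorem phgComponent_slice (a : Sph d → ℂ) (γ : ℂ) (ℓ : ℕ) (χ : ℝ → ℝ) (s : ℝ) (θ : Sph d)
    (y : perp θ) : phgComponent a γ ℓ χ (s • (θ : Euc d) + (y : Euc d)) =
      radialExt a (s • (θ : Euc d) + (y : Euc d)) *
        phgProfile γ ℓ χ ((1 - s ^ 2) - ‖y‖ ^ 2) := by
  rw [phgComponent_eq, norm_sq_smul_add_perp, sub_sub]

theorem IsCutoff.exists_bound {χ : ℝ → ℝ} (hχ : IsCutoff χ) :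
    ∃ C, ∀ t, 0 ≤ t → |χ t| ≤ C := by
  obtain ⟨c, hc, hzero⟩ := hχ.eq_zero
  obtain ⟨C, hC⟩ := (isCompact_Icc (a := (0 : ℝ)) (b := c)).exists_bound_of_continuousOn
    (hχ.smooth.continuousOn.mono fun t ht => ⟨ht.1, ht.2.trans_lt hc⟩)
  refine ⟨max C 0, fun t ht => ?_⟩
  rcases le_total c t with h | h
  · simp [hzero t h]
  · exact (hC t ⟨ht, h⟩).trans (le_max_left _ _)

/-- The scaled profile as a combination of the weights on the unit interval. -/
theorem pow_mul_phgProfile_scaled (D : ℕ) (γ : ℂ) (ℓ : ℕ) (χ : ℝ → ℝ) {σ t : ℝ} (hσ : 0 < σ)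
    (ht : t ∈ Ioo (0 : ℝ) 1) :
    ((√σ * t : ℝ) : ℂ) ^ (D - 1) * phgProfile γ ℓ χ (σ - (√σ * t) ^ 2) =
      ∑ k ∈ Finset.range (ℓ + 1), ((√σ : ℂ) ^ (D - 1) * (σ : ℂ) ^ γ * (ℓ.choose k : ℂ) *
        (Real.log σ : ℂ) ^ k) * (radialWeight D γ (ℓ - k) t * (χ (σ * (1 - t ^ 2)) : ℂ)) := by
  have h1 : 0 < 1 - t ^ 2 := by nlinarith [ht.1, ht.2]
  have h2 : σ - (√σ * t) ^ 2 = σ * (1 - t ^ 2) := by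
    rw [mul_pow, Real.sq_sqrt hσ.le]; ring
  rw [h2, phgProfile, if_pos (mul_pos hσ h1), Real.log_mul hσ.ne' h1.ne', Complex.ofReal_mul σ,
    Complex.mul_cpow_ofReal_nonneg hσ.le h1.le, Complex.ofReal_add, add_pow]
  simp only [Finset.mul_sum, Finset.sum_mul]
  refine Finset.sum_congr rfl fun k _ => ?_
  rw [radialWeight]
  push_cast
  ring

theorem phgProfile_of_nonpos (γ : ℂ) (ℓ : ℕ) (χ : ℝ → ℝ) {ρ : ℝ} (h : ρ ≤ 0) :
    phgProfile γ ℓ χ ρ = 0 := if_neg (not_lt.2 h)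

theorem integrableOn_radialWeight_mul_cutoff {D : ℕ} (hD : 1 ≤ D) {γ : ℂ} (hγ : -1 < γ.re) (j : ℕ)
    {χ : ℝ → ℝ} (hχ : IsCutoff χ) {σ : ℝ} (hσ : 0 < σ) (hσ1 : σ ≤ 1) :
    IntegrableOn (fun t => radialWeight D γ j t * (χ (σ * (1 - t ^ 2)) : ℂ)) (Ioo 0 1) := by
  obtain ⟨C, hC⟩ := hχ.exists_bound
  have hpos : ∀ t ∈ Ioo (0 : ℝ) 1, 0 < 1 - t ^ 2 ∧ 1 - t ^ 2 < 1 := fun t ht =>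
    ⟨by nlinarith [ht.1, ht.2], by nlinarith [ht.1, ht.2]⟩
  refine Integrable.mul_bdd (c := C) (integrableOn_radialWeight hD hγ j) ?_ ?_
  · refine ContinuousOn.aestronglyMeasurable ?_ measurableSet_Ioo
    refine Complex.continuous_ofReal.comp_continuousOn ?_
    refine hχ.smooth.continuousOn.comp (f := fun t : ℝ => σ * (1 - t ^ 2)) (by fun_prop) ?_
    intro t ht
    have := hpos t ht
    exact ⟨by nlinarith, by nlinarith⟩
  · filter_upwards [ae_restrict_mem measurableSet_Ioo] with t ht
    rw [Complex.norm_real, Real.norm_eq_abs]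
    exact hC _ (mul_nonneg hσ.le (hpos t ht).1.le)

theorem integrableOn_pow_mul_phgProfile {D : ℕ} (hD : 1 ≤ D) {γ : ℂ} (hγ : -1 < γ.re) (ℓ : ℕ)
    {χ : ℝ → ℝ} (hχ : IsCutoff χ) {σ : ℝ} (hσ1 : σ ≤ 1) :
    IntegrableOn (fun r : ℝ => (r : ℂ) ^ (D - 1) * phgProfile γ ℓ χ (σ - r ^ 2)) (Ioi 0) := by
  -- For `σ ≤ 0` the hyperplane misses the open ball; otherwise rescale to the unit interval.
  rcases le_or_gt σ 0 with hσ | hσ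
  · have h : (fun r : ℝ => (r : ℂ) ^ (D - 1) * phgProfile γ ℓ χ (σ - r ^ 2)) = fun _ => 0 := by
      funext r
      rw [phgProfile_of_nonpos _ _ _ (by nlinarith [sq_nonneg r]), mul_zero]
    rw [h]
    exact integrableOn_zero
  · have hs : 0 < √σ := Real.sqrt_pos.2 hσ
    have h1 := (integrableOn_Ioi_comp_mul_left_iff
      (fun r : ℝ => (r : ℂ) ^ (D - 1) * phgProfile γ ℓ χ (σ - r ^ 2)) 0 hs).1
    rw [mul_zero] at h1
    apply h1
    rw [← Ioo_union_Ici_eq_Ioi (zero_lt_one' ℝ), integrableOn_union]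
    constructor
    · refine IntegrableOn.congr_fun (integrable_finsetSum _ fun k _ =>
        (integrableOn_radialWeight_mul_cutoff hD hγ (ℓ - k) hχ hσ hσ1).const_mul _)
        (fun t ht => (pow_mul_phgProfile_scaled D γ ℓ χ hσ ht).symm) measurableSet_Ioo
    · refine integrableOn_zero.congr_fun (fun t ht => ?_) measurableSet_Ici
      have ht1 : (1 : ℝ) ≤ t := ht
      have h2 : σ - (√σ * t) ^ 2 ≤ 0 := by
        rw [mul_pow, Real.sq_sqrt hσ.le]
        nlinarith [mul_le_mul ht1 ht1 zero_le_one (by linarith)]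
      simp only
      rw [phgProfile_of_nonpos _ _ _ h2, mul_zero]

end Profile

/-! ### Reduction of the Radon transform to a one-dimensional integral. -/

section RadonFormula

variable {d : ℕ} {a : Sph d → ℂ}

theorem exists_bound_radialExt (ha : Continuous a) : ∃ C, ∀ x, ‖radialExt a x‖ ≤ C := by
  obtain ⟨C, hC⟩ := (isCompact_univ (X := Sph d)).exists_bound_of_continuousOn ha.continuousOn
  refine ⟨max C 0, fun x => ?_⟩
  by_cases hx : x = 0
  · simp [radialExt, hx]
  · rw [radialExt_eq hx]
    exact (hC _ (mem_univ _)).trans (le_max_left _ _)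

theorem nontrivial_perp (hd : 1 ≤ d) (θ : Sph d) : Nontrivial (perp θ) :=
  Module.nontrivial_of_finrank_pos (R := ℝ) (by rw [finrank_perp]; exact hd)

theorem integrable_phgComponent_slice (hd : 1 ≤ d) (ha : ContMDiff (𝓡 d) 𝓘(ℝ, ℂ) ∞ a) {γ : ℂ}
    (hγ : -1 < γ.re) (ℓ : ℕ) {χ : ℝ → ℝ} (hχ : IsCutoff χ) (s : ℝ) (θ : Sph d) :
    Integrable (fun y : perp θ => phgComponent a γ ℓ χ (s • (θ : Euc d) + (y : Euc d))) := by
  simp only [phgComponent_slice]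
  obtain ⟨C, hC⟩ := exists_bound_radialExt ha.continuous
  refine Integrable.bdd_mul (c := C) ?_ ?_ (Eventually.of_forall fun y => hC _)
  · have := nontrivial_perp hd θ
    refine (integrable_fun_norm_addHaar volume
      (f := fun r : ℝ => phgProfile γ ℓ χ ((1 - s ^ 2) - r ^ 2))).2 ?_
    have h := integrableOn_pow_mul_phgProfile hd hγ ℓ hχ (σ := 1 - s ^ 2)
      (by nlinarith [sq_nonneg s])
    simpa only [finrank_perp, Complex.real_smul, Complex.ofReal_pow] using h
  · have h1 : Measurable (radialExt a) :=
      measurable_of_continuousOn_compl_singleton 0 (contDiffOn_radialExt ha).continuousOn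
    have h2 : Measurable fun y : perp θ => s • (θ : Euc d) + (y : Euc d) :=
      Continuous.measurable (by fun_prop)
    exact (h1.comp h2).aestronglyMeasurable

theorem integral_sphere_radialExt (a : Sph d → ℂ) {s : ℝ} (hs : 0 < s) (θ : Sph d) (r : ℝ) :
    ∫ φ : Metric.sphere (0 : perp θ) 1,
      radialExt a (s • (θ : Euc d) + r • ((φ : perp θ) : Euc d))
        ∂(volume : Measure (perp θ)).toSphere = fiberIntegral a θ (r / s) := by
  rw [fiberIntegral]
  congr 1
  funext φ
  rw [← radialExt_smul a hs ((θ : Euc d) + (r / s) • ((φ : perp θ) : Euc d)), smul_add, smul_smul,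
    mul_div_cancel₀ _ hs.ne']

theorem radonTransform_eq_integral_Ioi (hd : 1 ≤ d) (ha : ContMDiff (𝓡 d) 𝓘(ℝ, ℂ) ∞ a) {γ : ℂ}
    (hγ : -1 < γ.re) (ℓ : ℕ) {χ : ℝ → ℝ} (hχ : IsCutoff χ) {s : ℝ} (hs : 0 < s) (θ : Sph d) :
    radonTransform (phgComponent a γ ℓ χ) s θ = ∫ r in Ioi (0 : ℝ),
      (r : ℂ) ^ (d - 1) * phgProfile γ ℓ χ ((1 - s ^ 2) - r ^ 2) *
        fiberIntegral a θ (r / s) := by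
  have := nontrivial_perp hd θ
  rw [radonTransform, integral_eq_integral_Ioi_sphere volume
    (integrable_phgComponent_slice hd ha hγ ℓ hχ s θ), finrank_perp]
  refine setIntegral_congr_fun measurableSet_Ioi fun r hr => ?_
  have hr0 : (0 : ℝ) < r := hr
  rw [mul_assoc, ← integral_sphere_radialExt a hs]
  congr 1
  rw [← integral_const_mul]
  refine integral_congr_ae (Eventually.of_forall fun φ => ?_)
  beta_reduce
  rw [phgComponent_slice, norm_smul, norm_eq_of_mem_sphere, mul_one, Real.norm_of_nonneg hr0.le,
    Submodule.coe_smul]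
  ring

/-- The coefficient of `σ^(d/2 + γ) log(σ)^k` in the Radon transform, as a function of
`r = √σ`. -/
noncomputable def radonLogCoeff (a : Sph d → ℂ) (γ : ℂ) (j : ℕ) (r : ℝ) (θ : Sph d) : ℂ :=
  ∫ t in Ioo (0 : ℝ) 1, radialWeight d γ j t * fiberIntegral a θ (r * t / √(1 - r ^ 2))

theorem integrableOn_radialWeight_mul_fiberIntegral (hd : 1 ≤ d)
    (ha : ContMDiff (𝓡 d) 𝓘(ℝ, ℂ) ∞ a) {γ : ℂ} (hγ : -1 < γ.re) (j : ℕ) (c : ℝ) (θ : Sph d) :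
    IntegrableOn (fun t => radialWeight d γ j t * fiberIntegral a θ (c * t)) (Ioo 0 1) := by
  have hcont : Continuous fun t => fiberIntegral a θ (c * t) :=
    (contDiff_fiberIntegral ha θ).continuous.comp (by fun_prop)
  obtain ⟨C, hC⟩ := (isCompact_Icc (a := (0 : ℝ)) (b := 1)).exists_bound_of_continuousOn
    hcont.continuousOn
  refine Integrable.mul_bdd (c := C) (integrableOn_radialWeight hd hγ j)
    hcont.aestronglyMeasurable ?_
  filter_upwards [ae_restrict_mem measurableSet_Ioo] with t ht
  exact hC t (Ioo_subset_Icc_self ht)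

theorem radonTransform_eq_sum (hd : 1 ≤ d) (ha : ContMDiff (𝓡 d) 𝓘(ℝ, ℂ) ∞ a) {γ : ℂ}
    (hγ : -1 < γ.re) (ℓ : ℕ) {χ : ℝ → ℝ} (hχ : IsCutoff χ) {σ : ℝ} (hσ : σ ∈ Ioo (0 : ℝ) 1)
    (h1 : ∀ t ∈ Icc 0 σ, χ t = 1) (θ : Sph d) :
    radonTransform (phgComponent a γ ℓ χ) (√(1 - σ)) θ = ∑ k ∈ Finset.range (ℓ + 1),
      (σ : ℂ) ^ ((d : ℂ) / 2 + γ) * (Real.log σ : ℂ) ^ k *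
        ((ℓ.choose k : ℂ) * radonLogCoeff a γ (ℓ - k) (√σ) θ) := by
  have hs : 0 < √σ := Real.sqrt_pos.2 hσ.1
  have hσ' : (0 : ℝ) < 1 - σ := by linarith [hσ.2]
  rw [radonTransform_eq_integral_Ioi hd ha hγ ℓ hχ (Real.sqrt_pos.2 hσ'), Real.sq_sqrt hσ'.le,
    sub_sub_cancel]
  have hscale := integral_comp_mul_left_Ioi (fun r : ℝ => (r : ℂ) ^ (d - 1) *
    phgProfile γ ℓ χ (σ - r ^ 2) * fiberIntegral a θ (r / √(1 - σ))) 0 hs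
  rw [mul_zero, eq_inv_smul_iff₀ hs.ne'] at hscale
  rw [← hscale]
  have hcut : ∫ t in Ioi (0 : ℝ), ((√σ * t : ℝ) : ℂ) ^ (d - 1) *
        phgProfile γ ℓ χ (σ - (√σ * t) ^ 2) * fiberIntegral a θ (√σ * t / √(1 - σ)) =
      ∫ t in Ioo (0 : ℝ) 1, ((√σ * t : ℝ) : ℂ) ^ (d - 1) *
        phgProfile γ ℓ χ (σ - (√σ * t) ^ 2) * fiberIntegral a θ (√σ * t / √(1 - σ)) := by
    -- Beyond `t = 1` the hyperplane has left the ball and the profile is zero.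
    refine setIntegral_eq_of_subset_of_forall_sdiff_eq_zero measurableSet_Ioi
      Ioo_subset_Ioi_self fun t ht => ?_
    have ht1 : (1 : ℝ) ≤ t := not_lt.1 fun h => ht.2 ⟨ht.1, h⟩
    have h2 : σ - (√σ * t) ^ 2 ≤ 0 := by
      rw [mul_pow, Real.sq_sqrt hσ.1.le]
      nlinarith [mul_le_mul ht1 ht1 zero_le_one (by linarith), hσ.1]
    rw [phgProfile_of_nonpos _ _ _ h2, mul_zero, zero_mul]
  rw [hcut]
  have hint : ∀ t ∈ Ioo (0 : ℝ) 1, ((√σ * t : ℝ) : ℂ) ^ (d - 1) *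
      phgProfile γ ℓ χ (σ - (√σ * t) ^ 2) * fiberIntegral a θ (√σ * t / √(1 - σ)) =
      ∑ k ∈ Finset.range (ℓ + 1), ((√σ : ℂ) ^ (d - 1) * (σ : ℂ) ^ γ * (ℓ.choose k : ℂ) *
        (Real.log σ : ℂ) ^ k) *
        (radialWeight d γ (ℓ - k) t * fiberIntegral a θ (√σ / √(1 - σ) * t)) := by
    intro t ht
    have hχ1 : χ (σ * (1 - t ^ 2)) = 1 := h1 _
      ⟨mul_nonneg hσ.1.le (by nlinarith [ht.1, ht.2]), by nlinarith [ht.1, ht.2, hσ.1]⟩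
    rw [pow_mul_phgProfile_scaled d γ ℓ χ hσ.1 ht, hχ1, Finset.sum_mul]
    refine Finset.sum_congr rfl fun k _ => ?_
    rw [mul_div_right_comm]
    push_cast
    ring
  rw [setIntegral_congr_fun measurableSet_Ioo hint, integral_finsetSum _ fun k _ =>
    (integrableOn_radialWeight_mul_fiberIntegral hd ha hγ (ℓ - k) _ θ).const_mul _,
    Finset.smul_sum]
  refine Finset.sum_congr rfl fun k _ => ?_
  -- One factor `√σ` comes from `dr = √σ dt`, the other `d - 1` from the polar density `r^(d-1)`.
  have hpow : (σ : ℂ) ^ ((d : ℂ) / 2 + γ) = (√σ : ℂ) * ((√σ : ℂ) ^ (d - 1) * (σ : ℂ) ^ γ) := by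
    rw [Complex.cpow_add _ _ (by exact_mod_cast hσ.1.ne'), ← mul_assoc, ← pow_succ',
      Nat.sub_add_cancel hd]
    congr 1
    rw [← Complex.ofReal_pow, Real.sqrt_eq_rpow, ← Real.rpow_natCast, ← Real.rpow_mul hσ.1.le,
      Complex.ofReal_cpow hσ.1.le]
    congr 1
    push_cast
    ring
  rw [integral_const_mul, hpow, Complex.real_smul, radonLogCoeff, Real.sq_sqrt hσ.1.le]
  simp only [mul_div_right_comm]
  ring

theorem radonTransform_neg (u : Euc d → ℂ) (s : ℝ) (θ : Sph d) :
    radonTransform u (-s) θ = radonTransform u s (-θ) := by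
  -- The subspaces `θ^⊥` and `(-θ)^⊥` are equal but index different types of integration; with
  -- variables in their place the equality can be substituted.
  have h : ∀ (P Q : Submodule ℝ (Euc d)), P = Q → ∀ v : Euc d,
      ∫ y : P, u (v + (y : Euc d)) = ∫ y : Q, u (v + (y : Euc d)) := by
    rintro P Q rfl v; rfl
  rw [radonTransform, radonTransform]
  have h1 : s • (((-θ : Sph d)) : Euc d) = (-s) • (θ : Euc d) := by simp
  rw [h1]
  refine h _ _ ?_ _
  rw [perp, perp, coe_neg_sphere, ← Set.neg_singleton, Submodule.span_neg]

end RadonFormula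

/-! ### The expansion, its remainder, and the two boundary components. -/

section Expansion

variable {d : ℕ} {a : Sph d → ℂ}

/-- The derivative of order `j` of `η ↦ B(η + 1, d/2 + p)` at `γ`. -/
noncomputable def betaDeriv (d : ℕ) (γ : ℂ) (j p : ℕ) : ℂ :=
  iteratedDeriv j (fun η : ℂ => Complex.betaIntegral (η + 1) ((d : ℂ) / 2 + p)) γ

theorem integral_pow_mul_radialWeight (hd : 1 ≤ d) {γ : ℂ} (hγ : -1 < γ.re) (j p : ℕ) :
    ∫ t in Ioo (0 : ℝ) 1, (t : ℂ) ^ (2 * p) * radialWeight d γ j t =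
      (1 / 2) * betaDeriv d γ j p := by
  simp only [pow_mul_radialWeight hd]
  rw [integral_radialWeight (by omega) hγ, betaDeriv]
  have h : (((d + 2 * p : ℕ) : ℂ) / 2) = (d : ℂ) / 2 + p := by push_cast; ring
  rw [h]

theorem chooseSub_eq_zero_of_lt : ∀ {m p : ℕ}, m < p → chooseSub m p = 0
  | 0, _ + 1, _ => rfl
  | _ + 1, _ + 1, h => Nat.choose_eq_zero_of_lt (by omega)

theorem one_sub_sq_pos {r : ℝ} (hr : r ∈ Ioo (-1 : ℝ) 1) : 0 < 1 - r ^ 2 := by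
  nlinarith [hr.1, hr.2]

/-- This is the Taylor remainder `q^(2N) R(q, x)` at `q = r t / √(1 - r²)`, divided by `r^(2N)`. -/
theorem contDiffOn_scaled_remainder {R : ℝ × Euc d → ℂ} (hR : ContDiffOn ℝ ∞ R (univ ×ˢ {0}ᶜ))
    (N : ℕ) : ContDiffOn ℝ ∞ (fun z : (ℝ × Euc d) × ℝ =>
      (((z.2 ^ (2 * N) * ((1 - z.1.1 ^ 2) ^ N)⁻¹ : ℝ)) : ℂ) *
        R (z.1.1 * z.2 / √(1 - z.1.1 ^ 2), z.1.2))
      ((Ioo (-1 : ℝ) 1 ×ˢ {0}ᶜ) ×ˢ univ) := by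
  have hne : ∀ z ∈ (Ioo (-1 : ℝ) 1 ×ˢ ({0}ᶜ : Set (Euc d))) ×ˢ (univ : Set ℝ),
      1 - z.1.1 ^ 2 ≠ 0 := fun z hz => (one_sub_sq_pos hz.1.1).ne'
  have h1 : ContDiffOn ℝ ∞ (fun z : (ℝ × Euc d) × ℝ => 1 - z.1.1 ^ 2)
      ((Ioo (-1 : ℝ) 1 ×ˢ {0}ᶜ) ×ˢ univ) := by fun_prop
  refine ContDiffOn.mul ?_ (hR.comp (f := fun z : (ℝ × Euc d) × ℝ =>
    (z.1.1 * z.2 / √(1 - z.1.1 ^ 2), z.1.2)) ?_ fun z hz => ⟨mem_univ _, hz.1.2⟩)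
  · refine Complex.ofRealCLM.contDiff.comp_contDiffOn (ContDiffOn.mul (by fun_prop) ?_)
    exact (h1.pow N).inv fun z hz => pow_ne_zero N (hne z hz)
  · refine ContDiffOn.prodMk (ContDiffOn.div (by fun_prop) (h1.sqrt hne) fun z hz => ?_)
      (by fun_prop)
    exact (Real.sqrt_pos.2 (one_sub_sq_pos hz.1.1)).ne'

/-- Admitting both signs of `r` makes `r = 0` an interior point, so smoothness up to the boundary
follows from parametric integration over an open set. The factor `2` of the even Taylor expansion
cancels the half in the moments. -/
theorem exists_radonLogCoeff_expansion (hd : 1 ≤ d) (ha : ContMDiff (𝓡 d) 𝓘(ℝ, ℂ) ∞ a) {γ : ℂ}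
    (hγ : -1 < γ.re) (j N : ℕ) :
    ∃ h : ℝ × Euc d → ℂ, ContDiffOn ℝ ∞ h (Ioo (-1) 1 ×ˢ {0}ᶜ) ∧
      ∀ r ∈ Ioo (-1 : ℝ) 1, ∀ θ : Sph d, radonLogCoeff a γ j r θ =
        ∑ m ∈ Finset.range N, (r : ℂ) ^ (2 * m) * (∑ p ∈ Finset.range (m + 1),
          fiberCoeff a p θ * (chooseSub m p : ℂ) * betaDeriv d γ j p) +
        (r : ℂ) ^ (2 * N) * h (r, (θ : Euc d)) := by
  obtain ⟨R, hR, hRF⟩ := exists_fiberExt_taylor ha N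
  choose E hE hEw using exists_div_one_sub_pow_expansion N
  let g : (ℝ × Euc d) × ℝ → ℂ := fun z =>
    (((z.2 ^ (2 * N) * ((1 - z.1.1 ^ 2) ^ N)⁻¹ : ℝ)) : ℂ) *
      R (z.1.1 * z.2 / √(1 - z.1.1 ^ 2), z.1.2)
  have hg : ContDiffOn ℝ ∞ g ((Ioo (-1 : ℝ) 1 ×ˢ {0}ᶜ) ×ˢ univ) :=
    contDiffOn_scaled_remainder hR N
  have hopen : IsOpen (Ioo (-1 : ℝ) 1 ×ˢ ({0}ᶜ : Set (Euc d))) :=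
    isOpen_Ioo.prod isOpen_compl_singleton
  have hK : ∀ᵐ t ∂(volume.restrict (Ioo (0 : ℝ) 1)), t ∈ Icc (0 : ℝ) 1 :=
    (ae_restrict_mem measurableSet_Ioo).mono fun t ht => Ioo_subset_Icc_self ht
  have hint := contDiffOn_integral_weight_smul (integrableOn_radialWeight hd hγ j)
    (π := fun t : ℝ => t) aestronglyMeasurable_id isCompact_Icc hK hopen hg
  -- Two truncation errors: that of `(w / (1 - w))^p` at `w = r²`, and that of the Taylor expansion
  -- of the fibre integral.
  refine ⟨fun q => ∑ p ∈ Finset.range N, fiberCoeff a p (sphProj q.2) * betaDeriv d γ j p *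
      (E p (q.1 ^ 2) : ℂ) + ∫ t in Ioo (0 : ℝ) 1, radialWeight d γ j t • g (q, t), ?_, ?_⟩
  · refine ContDiffOn.add (ContDiffOn.sum fun p _ => ContDiffOn.mul (ContDiffOn.mul ?_
      contDiffOn_const) ?_) hint
    · exact (contDiffOn_fiberCoeff_sphProj ha p).comp (f := fun q : ℝ × Euc d => q.2)
        (by fun_prop) fun q hq => hq.2
    · refine Complex.ofRealCLM.contDiff.comp_contDiffOn ((hE p).comp
        (f := fun q : ℝ × Euc d => q.1 ^ 2) (by fun_prop) fun q hq => ?_)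
      have := one_sub_sq_pos hq.1
      exact sub_pos.1 this
  · intro r hr θ
    have hr1 := one_sub_sq_pos hr
    have hθ : (θ : Euc d) ≠ 0 := ne_zero_of_mem_unit_sphere θ
    have hq : ∀ (t : ℝ) (p : ℕ), ((r * t / √(1 - r ^ 2) : ℝ) : ℂ) ^ (2 * p) =
        (((r ^ 2 / (1 - r ^ 2)) ^ p : ℝ) : ℂ) * (t : ℂ) ^ (2 * p) := by
      intro t p
      rw [← Complex.ofReal_pow, ← Complex.ofReal_pow, ← Complex.ofReal_mul]
      congr 1
      rw [pow_mul, pow_mul, ← mul_pow, div_pow, Real.sq_sqrt hr1.le]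
      congr 1
      ring
    have hF : ∀ t : ℝ, radialWeight d γ j t * fiberIntegral a θ (r * t / √(1 - r ^ 2)) =
        ∑ p ∈ Finset.range N, (2 * fiberCoeff a p θ * (((r ^ 2 / (1 - r ^ 2)) ^ p : ℝ) : ℂ)) *
          ((t : ℂ) ^ (2 * p) * radialWeight d γ j t) +
        (r : ℂ) ^ (2 * N) * (radialWeight d γ j t • g ((r, (θ : Euc d)), t)) := by
      intro t
      have h1 := hRF (r * t / √(1 - r ^ 2)) θ hθ
      rw [fiberExt, sphProj_coe] at h1
      simp only at h1
      rw [h1, mul_add, Finset.mul_sum]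
      congr 1
      · refine Finset.sum_congr rfl fun p _ => ?_
        rw [hq]
        ring
      · rw [hq, div_pow, ← pow_mul, smul_eq_mul]
        simp only [g]
        push_cast
        ring
    have hterm : ∀ p, IntegrableOn (fun t : ℝ => (2 * fiberCoeff a p θ *
        (((r ^ 2 / (1 - r ^ 2)) ^ p : ℝ) : ℂ)) * ((t : ℂ) ^ (2 * p) * radialWeight d γ j t))
        (Ioo 0 1) := by
      intro p
      simp only [pow_mul_radialWeight hd]
      exact (integrableOn_radialWeight (by omega) hγ j).const_mul _
    have hsumint : IntegrableOn (fun t : ℝ => ∑ p ∈ Finset.range N, (2 * fiberCoeff a p θ *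
        (((r ^ 2 / (1 - r ^ 2)) ^ p : ℝ) : ℂ)) * ((t : ℂ) ^ (2 * p) * radialWeight d γ j t))
        (Ioo 0 1) := integrable_finsetSum _ fun p _ => hterm p
    have htot : IntegrableOn (fun t => radialWeight d γ j t *
        fiberIntegral a θ (r * t / √(1 - r ^ 2))) (Ioo 0 1) := by
      simpa only [mul_div_right_comm] using
        integrableOn_radialWeight_mul_fiberIntegral hd ha hγ j (r / √(1 - r ^ 2)) θ
    -- Integrability of the remainder is inherited: it is the whole integrand minus the Taylor sum.
    have hrem : IntegrableOn (fun t => (r : ℂ) ^ (2 * N) *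
        (radialWeight d γ j t • g ((r, (θ : Euc d)), t))) (Ioo 0 1) := by
      refine (htot.sub hsumint).congr (Eventually.of_forall fun t => ?_)
      simp only [Pi.sub_apply, hF t]
      ring
    -- Since `chooseSub m p = 0` for `p > m`, the inner range can be made independent of `m`, which
    -- allows the two sums to be exchanged.
    have hcoef : ∑ m ∈ Finset.range N, (r : ℂ) ^ (2 * m) * (∑ p ∈ Finset.range (m + 1),
        fiberCoeff a p θ * (chooseSub m p : ℂ) * betaDeriv d γ j p) =
        ∑ m ∈ Finset.range N, (r : ℂ) ^ (2 * m) * (∑ p ∈ Finset.range N,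
          fiberCoeff a p θ * (chooseSub m p : ℂ) * betaDeriv d γ j p) := by
      refine Finset.sum_congr rfl fun m hm => ?_
      congr 1
      refine Finset.sum_subset (Finset.range_mono (Finset.mem_range.1 hm)) fun p _ hp => ?_
      rw [chooseSub_eq_zero_of_lt (by simpa using hp)]
      simp
    rw [hcoef, radonLogCoeff]
    simp only [hF]
    rw [integral_add hsumint hrem, integral_finsetSum _ fun p _ => hterm p, integral_const_mul]
    simp only [integral_const_mul, integral_pow_mul_radialWeight hd hγ, sphProj_coe]
    rw [mul_add, ← add_assoc]
    congr 1
    simp only [Finset.mul_sum]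
    rw [Finset.sum_comm, ← Finset.sum_add_distrib]
    refine Finset.sum_congr rfl fun p _ => ?_
    rw [hEw p _ (sub_pos.1 hr1)]
    push_cast
    rw [mul_add, add_mul, Finset.mul_sum, Finset.sum_mul]
    congr 1
    · refine Finset.sum_congr rfl fun m _ => ?_
      rw [pow_mul]
      ring
    · rw [pow_mul]
      ring

theorem isLogSmooth_radon_remainder (hd : 1 ≤ d) (ha : ContMDiff (𝓡 d) 𝓘(ℝ, ℂ) ∞ a) {γ : ℂ}
    (hγ : -1 < γ.re) (ℓ : ℕ) {χ : ℝ → ℝ} (hχ : IsCutoff χ) {ε : ℝ} (hε1 : ε < 1)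
    (h1 : ∀ t ∈ Icc 0 ε, χ t = 1) (N : ℕ) :
    IsLogSmooth ε ((d : ℂ) / 2 + γ + N) (fun p : ℝ × Sph d =>
      radonTransform (phgComponent a γ ℓ χ) (√(1 - p.1)) p.2 -
      ∑ m ∈ Finset.range N, ∑ k ∈ Finset.range (ℓ + 1),
        (p.1 : ℂ) ^ ((d : ℂ) / 2 + γ + m) * (Real.log p.1 : ℂ) ^ k *
          radonCoeff (fiberCoeff a) γ ℓ m k p.2) := by
  choose h hh hexp using fun j => exists_radonLogCoeff_expansion hd ha hγ j N
  refine ⟨ℓ + 1, fun k q => (ℓ.choose k : ℂ) * h (ℓ - k) q, fun k => ?_, fun p hp => ?_⟩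
  · refine contDiffOn_const.mul ((hh (ℓ - k)).mono (prod_mono_left fun r hr => ⟨?_, ?_⟩))
    · linarith [hr.1]
    · exact hr.2.trans (by rw [Real.sqrt_lt' one_pos]; simpa using hε1)
  · have hp1 : p.1 ∈ Ioo (0 : ℝ) 1 := ⟨hp.1, hp.2.trans hε1⟩
    have hs : √p.1 ∈ Ioo (-1 : ℝ) 1 := by
      refine ⟨by linarith [Real.sqrt_nonneg p.1], ?_⟩
      rw [Real.sqrt_lt' one_pos]
      simpa using hp1.2
    have hpow : ∀ m : ℕ, (√p.1 : ℂ) ^ (2 * m) = (p.1 : ℂ) ^ m := by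
      intro m
      rw [pow_mul, ← Complex.ofReal_pow, Real.sq_sqrt hp.1.le]
    have hcpow : ∀ m : ℕ, (p.1 : ℂ) ^ ((d : ℂ) / 2 + γ + m) =
        (p.1 : ℂ) ^ ((d : ℂ) / 2 + γ) * (p.1 : ℂ) ^ m := by
      intro m
      rw [Complex.cpow_add _ _ (by exact_mod_cast hp.1.ne'), Complex.cpow_natCast]
    beta_reduce
    rw [radonTransform_eq_sum hd ha hγ ℓ hχ hp1 (fun t ht => h1 t ⟨ht.1, ht.2.trans hp.2.le⟩),
      Finset.sum_comm, ← Finset.sum_sub_distrib]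
    refine Finset.sum_congr rfl fun k _ => ?_
    -- At `r = √σ` the factor `r^(2N)` is `σ^N`, which raises the exponent to `d/2 + γ + N`.
    rw [hexp (ℓ - k) _ hs, hcpow, sub_eq_iff_eq_add, mul_add, mul_add, Finset.mul_sum,
      Finset.mul_sum, add_comm, hpow]
    congr 1
    · ring
    · refine Finset.sum_congr rfl fun m _ => ?_
      rw [hcpow, hpow, radonCoeff]
      simp only [betaDeriv]
      ring

theorem IsLogSmooth.comp_neg {ε : ℝ} {w : ℂ} {f : ℝ × Sph d → ℂ} (hf : IsLogSmooth ε w f) :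
    IsLogSmooth ε w (fun p => f (p.1, -p.2)) := by
  obtain ⟨K, h, hh, hfh⟩ := hf
  refine ⟨K, fun k q => h k (q.1, -q.2), fun k => ?_, fun p hp => ?_⟩
  · exact (hh k).comp (f := fun q : ℝ × Euc d => (q.1, -q.2)) (by fun_prop)
      fun q hq => ⟨hq.1, neg_ne_zero.2 hq.2⟩
  · simpa using hfh (p.1, -p.2) hp

theorem contMDiff_radonCoeff (ha : ContMDiff (𝓡 d) 𝓘(ℝ, ℂ) ∞ a) (γ : ℂ) (ℓ m k : ℕ) :
    ContMDiff (𝓡 d) 𝓘(ℝ, ℂ) ∞ (radonCoeff (fiberCoeff a) γ ℓ m k) := by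
  have h : ContDiffOn ℝ ∞ (fun x => radonCoeff (fiberCoeff a) γ ℓ m k (sphProj x)) {0}ᶜ :=
    contDiffOn_const.mul (ContDiffOn.sum fun p _ =>
      ((contDiffOn_fiberCoeff_sphProj ha p).mul contDiffOn_const).mul contDiffOn_const)
  simpa only [sphProj_coe] using contMDiff_of_contDiffOn_compl_zero h

/-- The collar depends on `χ` only, so one `ε` serves every `N` and `t`. -/
theorem IsCutoff.exists_collar {χ : ℝ → ℝ} (hχ : IsCutoff χ) :
    ∃ ε : ℝ, 0 < ε ∧ ε < 1 ∧ ∀ t ∈ Icc 0 ε, χ t = 1 := by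
  obtain ⟨δ, hδ, h⟩ := hχ.eq_one
  exact ⟨min δ (1 / 2), by positivity, (min_le_right _ _).trans_lt (by norm_num),
    fun t ht => h t ⟨ht.1, ht.2.trans (min_le_left _ _)⟩⟩

theorem hasPhgExpansion_radonTransform (hd : 1 ≤ d) (ha : ContMDiff (𝓡 d) 𝓘(ℝ, ℂ) ∞ a) {γ : ℂ}
    (hγ : -1 < γ.re) (ℓ : ℕ) {χ : ℝ → ℝ} (hχ : IsCutoff χ) :
    HasPhgExpansion (𝓡 d)
      (fun q : ℝ × Sph d => radonTransform (phgComponent a γ ℓ χ) (√(1 - q.1)) q.2)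
      ((d : ℂ) / 2 + γ) ℓ (fun m k θ => radonCoeff (fiberCoeff a) γ ℓ m k θ) := by
  obtain ⟨ε, hε, hε1, h1⟩ := hχ.exists_collar
  refine ⟨fun m k _ => contMDiff_radonCoeff ha γ ℓ m k, ε, hε, hε1, fun t N ht => ?_⟩
  exact (isLogSmooth_radon_remainder hd ha hγ ℓ hχ hε1 h1 N).isConormal hε1.le (by simpa using ht)

theorem hasPhgExpansion_radonTransform_neg (hd : 1 ≤ d) (ha : ContMDiff (𝓡 d) 𝓘(ℝ, ℂ) ∞ a)
    {γ : ℂ} (hγ : -1 < γ.re) (ℓ : ℕ) {χ : ℝ → ℝ} (hχ : IsCutoff χ) :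
    HasPhgExpansion (𝓡 d)
      (fun q : ℝ × Sph d => radonTransform (phgComponent a γ ℓ χ) (-√(1 - q.1)) q.2)
      ((d : ℂ) / 2 + γ) ℓ (fun m k θ => radonCoeff (fiberCoeff a) γ ℓ m k (-θ)) := by
  have := Fact.mk (@finrank_euclideanSpace_fin ℝ _ (d + 1))
  obtain ⟨ε, hε, hε1, h1⟩ := hχ.exists_collar
  refine ⟨fun m k _ => (contMDiff_radonCoeff ha γ ℓ m k).comp contMDiff_neg_sphere, ε, hε, hε1,
    fun t N ht => ?_⟩
  simp only [radonTransform_neg]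
  exact (isLogSmooth_radon_remainder hd ha hγ ℓ hχ hε1 h1 N).comp_neg.isConormal hε1.le
    (by simpa using ht)

end Expansion

/-- The ambient dimension is `n = d + 1 ≥ 2`, so that `(n - 1) / 2 = d / 2`. Near each of the two
boundary components `s = 1` and `s = -1` the coordinate is `σ = 1 - s²`, that is
`s = ± √(1 - σ)`, and the coefficients are evaluated at `(s / |s|) θ = ± θ`. -/
theorem theorem2p1 (d : ℕ) (hd : 1 ≤ d) (a : Sph d → ℂ) (ha : ContMDiff (𝓡 d) 𝓘(ℝ, ℂ) ∞ a) :
    ∃ A : ℕ → Sph d → ℂ,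
      (∀ p, ContMDiff (𝓡 d) 𝓘(ℝ, ℂ) ∞ (A p)) ∧
      (∀ θ, ContDiff ℝ ∞ (fiberIntegral a θ)) ∧
      (∀ p θ, A p θ = fiberCoeff a p θ) ∧
      ∀ (γ : ℂ) (ℓ : ℕ) (χ : ℝ → ℝ), -1 < γ.re → IsCutoff χ →
        (∀ (s : ℝ) (θ : Sph d), MeasureTheory.Integrable
          (fun y : perp θ => phgComponent a γ ℓ χ (s • (θ : Euc d) + (y : Euc d)))) ∧
        HasPhgExpansion (𝓡 d)
          (fun q : ℝ × Sph d => radonTransform (phgComponent a γ ℓ χ) (√(1 - q.1)) q.2)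
          ((d : ℂ) / 2 + γ) ℓ (fun m k θ => radonCoeff A γ ℓ m k θ) ∧
        HasPhgExpansion (𝓡 d)
          (fun q : ℝ × Sph d => radonTransform (phgComponent a γ ℓ χ) (-√(1 - q.1)) q.2)
          ((d : ℂ) / 2 + γ) ℓ (fun m k θ => radonCoeff A γ ℓ m k (-θ)) := by
  refine ⟨fiberCoeff a, contMDiff_fiberCoeff ha, contDiff_fiberIntegral ha, fun _ _ => rfl,
    fun γ ℓ χ hγ hχ => ⟨fun s θ => integrable_phgComponent_slice hd ha hγ ℓ hχ s θ,
      hasPhgExpansion_radonTransform hd ha hγ ℓ hχ,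
      hasPhgExpansion_radonTransform_neg hd ha hγ ℓ hχ⟩⟩
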